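/- All norms of operators are spectral norms. A unitary $U$ on $m+n$ qubits is an $(\alpha,m,\epsilon)$-block encoding of an $n$-qubit operator $A$ if $\alpha\ge\|A\|$ and $\big\|A-\alpha(\langle 0^m|\otimes I_n)\,U\,(|0^m\rangle\otimes I_n)\big\|\le\epsilon$. Elementary gates are arbitrary one- and two-qubit unitaries. There is a universal constant $C>0$ such that the following holds. Let $n,m\ge 0$ be integers, $0<\eta\le\alpha_A$ and $\epsilon\in(0,\tfrac12]$. There are an odd real polynomial $p_d$ of degree $$d\le C\,\frac{\alpha_A}{\eta}\,\max\Big\{1,\log\frac1{\eta\epsilon}\Big\}$$ (so $d=O\big(\frac{\alpha_A}{\eta}\log\frac{1}{\eta\epsilon}\big)$ whenever $\eta\epsilon\le\frac12$) and a quantum circuit on $m+1+n$ qubits with black-box access to a unitary on $m+n$ qubits, which makes exactly $d$ queries in total to the black box and its inverse, and uses at most $C\,d\,(m+n+1)$ elementary gates, such that for every positive semidefinite $n$-qubit operator $A$ whose smallest nonzero eigenvalue is $\eta$ and every $(\alpha_A,m,0)$-block encoding $U_A$ of $A$, the unitary $U_p$ implemented by the circuit with black box $U_A$ is a $\big(\tfrac{4}{3\eta},m+1,0\big)$-block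 encoding of $p_d(A/\alpha_A)$, and $$\Big\|\tfrac{4}{3\eta}\,(\langle 0^{m+1}|\otimes I_n)\,U_p\,(|0^{m+1}\rangle\otimes I_n)-A^+\Big\|\le\epsilon ,$$ where $A^+$ is the Moore–Penrose inverse of $A$. -/

import Mathlib

open scoped Matrix ComplexOrder Matrix.Norms.L2Operator

/-- Operators on a register of qubits labelled by `W`, as complex matrices in the computational
basis: basis states are bit strings `W → Fin 2`, so for `W = Fin n` these are the
`2 ^ n × 2 ^ n` matrices.  Norms of such matrices are spectral (`ℓ²` operator) norms. -/
abbrev QOperator (W : Type) : Type := Matrix (W → Fin 2) (W → Fin 2) ℂ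

/-- The top-left block `(⟨0^m| ⊗ I_n) U (|0^m⟩ ⊗ I_n)`, where the `m` ancilla qubits are
`Fin m` and the `n` system qubits are `Fin n`. -/
def ancillaBlock {m n : ℕ} (U : QOperator (Fin m ⊕ Fin n)) : QOperator (Fin n) :=
  fun x y => U (Sum.elim (fun _ => 0) x) (Sum.elim (fun _ => 0) y)

/-- `U` is an `(α, m, ε)`-block encoding of the `n`-qubit operator `A`. -/
structure IsBlockEncoding {n : ℕ} (α : ℝ) (m : ℕ) (ε : ℝ)
    (U : QOperator (Fin m ⊕ Fin n)) (A : QOperator (Fin n)) : Prop where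
  unitary : U ∈ Matrix.unitaryGroup ((Fin m ⊕ Fin n) → Fin 2) ℂ
  norm_le : ‖A‖ ≤ α
  error_le : ‖A - α • ancillaBlock U‖ ≤ ε

/-- `B` is the Moore–Penrose inverse of `A`: the four Penrose conditions (they have exactly one
solution `B` for every `A`). -/
structure IsMoorePenroseInverse {ι : Type} [Fintype ι] (A B : Matrix ι ι ℂ) : Prop where
  mul_mul_left : A * B * A = A
  mul_mul_right : B * A * B = B
  isHermitian_left : (A * B).IsHermitian
  isHermitian_right : (B * A).IsHermitian

/-- The operator on the register `W` that applies `V` to the qubits selected by `e` (the wire `k`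
of `V` is the qubit `e k`) and the identity to all other qubits. -/
noncomputable def applyOn {K W : Type} (e : K ↪ W) (V : QOperator K) : QOperator W :=
  open Classical in
  fun x y => if ∀ w, w ∉ Set.range e → x w = y w then V (x ∘ e) (y ∘ e) else 0

/-- One step of a quantum circuit on the register `W` with access to a black-box unitary acting on
qubits labelled by `Q`: an elementary gate, which is an arbitrary one- or two-qubit unitary on
chosen qubits, or one query to the black box or to its inverse on chosen qubits. -/
inductive CircuitStep (Q W : Type) : Type
  | gate (k : ℕ) (hk : k = 1 ∨ k = 2) (e : Fin k ↪ W)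
      (V : Matrix.unitaryGroup (Fin k → Fin 2) ℂ) : CircuitStep Q W
  | query (e : Q ↪ W) : CircuitStep Q W
  | queryInv (e : Q ↪ W) : CircuitStep Q W

/-- The operator that a step performs when the black box is `U`. -/
noncomputable def CircuitStep.toOperator {Q W : Type} (U : QOperator Q) :
    CircuitStep Q W → QOperator W
  | .gate _ _ e V => applyOn e V.1
  | .query e => applyOn e U
  | .queryInv e => applyOn e Uᴴ

/-- A quantum circuit with black-box access; the head of the list is the step applied first.
The steps do not depend on the black box. -/
abbrev QueryCircuit (Q W : Type) : Type := List (CircuitStep Q W)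

namespace QueryCircuit

/-- The operator that the circuit implements when the black box is `U`. -/
noncomputable def toOperator {Q W : Type} [Fintype W] [DecidableEq W] (U : QOperator Q) :
    QueryCircuit Q W → QOperator W
  | [] => 1
  | s :: c => toOperator U c * s.toOperator U

/-- Total number of queries to the black box and to its inverse. -/
def queryCount {Q W : Type} : QueryCircuit Q W → ℕ
  | [] => 0
  | .gate _ _ _ _ :: c => queryCount c
  | .query _ :: c => queryCount c + 1
  | .queryInv _ :: c => queryCount c + 1

/-- Number of elementary gates. -/
def gateCount {Q W : Type} : QueryCircuit Q W → ℕ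
  | [] => 0
  | .gate _ _ _ _ :: c => gateCount c + 1
  | .query _ :: c => gateCount c
  | .queryInv _ :: c => gateCount c

end QueryCircuit

/-! The circuit applies to `A / α` an odd polynomial that is close to the inverse function on `[η,
α]` and vanishes at `0`. Three ingredients carry this: a filter polynomial, quantum signal
processing, and a gate-level circuit without extra workspace.

Filter (`exists_filterPolynomial`). With `a = η / α`, let `D` be a Dirichlet kernel of order about
`1 / a`, normalized so that `D = 1` at `x = 0` and rescaled so that `|D| ≤ 1/2` for `a ≤ x ≤ 1`.
Then `s = 1 - D²` vanishes at `0` and is at least `3/4` on `[a, 1]`. Inserting `s` into the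
probability of at least `2 M` successes in `3 M` trials gives an even polynomial `F` with `F(0) =
0`, `0 ≤ F ≤ 1`, and `1 - F` exponentially small in `M` on `[a, 1]`. The quotient `F(x) / x = x
R(x²)` is an odd polynomial close to `1 / x` there, and Markov's inequality for small `s` gives
`F(x) / x ≤ 4 / (3 a)` on `(0, 1]`. This is the source of the factor `4 / (3 η)`. A choice of `M` of
order `log (1 / (η ε))` makes the error in `A⁺` at most `ε`.

Signal processing (`alternatingSequence_mul_zeroIsometry`, `exists_sequencePair_re`). Alternating
`U`, `Uᴴ` and phases `exp (i φ (2 Π - 1))` leaves invariant a space on which the product is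
described by a pair of polynomials in `AᴴA`, with `A` the encoded block. Conversely, every
normalized pair arises from some phases, by peeling off one phase at a time (`exists_sequencePair`).
A real `r` with `|x r(x²)| ≤ 1` on `(0, 1)` is completed to such a pair by the Markov–Lukács
representation of `1 - y r(y)²`.

Circuit (`exists_circuit_average`). Negating all phases conjugates the polynomials, so the mean of
the two sequences keeps only the real part. One extra ancilla between Hadamard gates takes this
mean. It controls only the signs of the phases, so the queries stay uncontrolled. The phases need
linearly many gates because each half of the ancillas serves as borrowed workspace for flips
controlled by the other half. -/

set_option linter.unusedSectionVars false

/-! ### Operators acting on part of a register -/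

section Register

variable {K W : Type}

/-- Two basis states of the register `W` agree on all qubits outside the range of `e`. -/
def AgreeOff (e : K ↪ W) (x y : W → Fin 2) : Prop := ∀ w, w ∉ Set.range e → x w = y w

theorem AgreeOff.symm {e : K ↪ W} {x y : W → Fin 2} (h : AgreeOff e x y) : AgreeOff e y x :=
  fun w hw => (h w hw).symm

theorem AgreeOff.trans {e : K ↪ W} {x y z : W → Fin 2} (h : AgreeOff e x y)
    (h' : AgreeOff e y z) : AgreeOff e x z :=
  fun w hw => (h w hw).trans (h' w hw)

theorem agreeOff_extend (e : K ↪ W) (u : K → Fin 2) (y : W → Fin 2) :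
    AgreeOff e (Function.extend e u y) y :=
  fun _ hw => Function.extend_apply' _ _ _ hw

theorem AgreeOff.eq_of_comp_eq {e : K ↪ W} {x y : W → Fin 2} (h : AgreeOff e x y)
    (h' : x ∘ e = y ∘ e) : x = y := by
  funext w
  by_cases hw : w ∈ Set.range e
  · obtain ⟨k, rfl⟩ := hw
    exact congrFun h' k
  · exact h w hw

theorem extend_comp_self (e : K ↪ W) (u : K → Fin 2) (y : W → Fin 2) :
    Function.extend e u y ∘ e = u :=
  Function.extend_comp e.injective u y

theorem AgreeOff.extend_eq {e : K ↪ W} {x y : W → Fin 2} (h : AgreeOff e x y) :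
    Function.extend e (x ∘ e) y = x :=
  AgreeOff.eq_of_comp_eq ((agreeOff_extend e _ y).trans h.symm) (extend_comp_self e _ y)

-- States that agree with `y` off the selected qubits are parametrized by the values on those
-- qubits; this reduces matrix products on `W` to matrix products on `K`.
open Classical in
theorem sum_ite_agreeOff [Fintype K] [Fintype W] [DecidableEq K] [DecidableEq W] (e : K ↪ W) (y : W → Fin 2)
    (f : (W → Fin 2) → ℂ) :
    (∑ z, if AgreeOff e z y then f z else 0) = ∑ u : K → Fin 2, f (Function.extend e u y) := by
  rw [← Finset.sum_filter]
  refine Finset.sum_bij' (fun z _ => z ∘ e) (fun u _ => Function.extend e u y) ?_ ?_ ?_ ?_ ?_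
  · simp
  · intro u _
    simpa using agreeOff_extend e u y
  · intro z hz
    exact AgreeOff.extend_eq (by simpa using hz)
  · intro u _
    exact extend_comp_self e u y
  · intro z hz
    rw [AgreeOff.extend_eq (by simpa using hz)]

open Classical in
/-- The operator that applies `V x` to the qubits selected by `e`, where `x` is the state of the
remaining qubits. -/
noncomputable def applyFamily (e : K ↪ W) (V : (W → Fin 2) → QOperator K) : QOperator W :=
  fun x y => if AgreeOff e x y then V x (x ∘ e) (y ∘ e) else 0

theorem applyOn_eq_applyFamily (e : K ↪ W) (V : QOperator K) :
    applyOn e V = applyFamily e (fun _ => V) := rfl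

/-- The hypothesis says that `V'` ignores the selected qubits, so the first operator to act does not
change which member of the family follows. -/
theorem applyFamily_mul [Fintype K] [Fintype W] [DecidableEq K] [DecidableEq W] (e : K ↪ W)
    (V V' : (W → Fin 2) → QOperator K) (h : ∀ x z, AgreeOff e x z → V' x = V' z) :
    applyFamily e V * applyFamily e V' = applyFamily e (fun x => V x * V' x) := by
  classical
  ext x y
  rw [Matrix.mul_apply]
  by_cases hxy : AgreeOff e x y
  · have key : ∀ z, applyFamily e V x z * applyFamily e V' z y =
        if AgreeOff e z y then V x (x ∘ e) (z ∘ e) * V' x (z ∘ e) (y ∘ e) else 0 := by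
      intro z
      by_cases hz : AgreeOff e z y
      · have hxz : AgreeOff e x z := hxy.trans hz.symm
        simp only [applyFamily, hz, hxz, if_true, h x z hxz]
      · simp [applyFamily, hz]
    rw [Finset.sum_congr rfl fun z _ => key z, sum_ite_agreeOff]
    simp only [applyFamily, hxy, if_true, Matrix.mul_apply, extend_comp_self]
  · rw [show applyFamily e (fun x => V x * V' x) x y = 0 by simp [applyFamily, hxy]]
    refine Finset.sum_eq_zero fun z _ => ?_
    by_cases hz : AgreeOff e z y
    · have hxz : ¬ AgreeOff e x z := fun h' => hxy (h'.trans hz)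
      simp [applyFamily, hxz]
    · simp [applyFamily, hz]

theorem applyFamily_diagonal [DecidableEq W] [DecidableEq K] [Fintype W] [Fintype K] (e : K ↪ W)
    (g : (W → Fin 2) → (K → Fin 2) → ℂ) :
    applyFamily e (fun x => Matrix.diagonal (g x)) = Matrix.diagonal (fun x => g x (x ∘ e)) := by
  ext x y
  by_cases hxy : x = y
  · subst hxy
    simp [applyFamily, AgreeOff]
  · rw [Matrix.diagonal_apply_ne _ hxy]
    by_cases h : AgreeOff e x y
    · have : x ∘ e ≠ y ∘ e := fun h' => hxy (h.eq_of_comp_eq h')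
      simp [applyFamily, h, Matrix.diagonal_apply_ne _ this]
    · simp [applyFamily, h]

variable [Fintype K] [Fintype W] [DecidableEq K] [DecidableEq W]

theorem applyOn_mul (e : K ↪ W) (V V' : QOperator K) :
    applyOn e V * applyOn e V' = applyOn e (V * V') := by
  simp only [applyOn_eq_applyFamily]
  exact applyFamily_mul e _ _ fun _ _ _ => rfl

theorem applyOn_diagonal (e : K ↪ W) (g : (K → Fin 2) → ℂ) :
    applyOn e (Matrix.diagonal g) = Matrix.diagonal (fun x => g (x ∘ e)) := by
  rw [applyOn_eq_applyFamily]
  exact applyFamily_diagonal e fun _ => g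

theorem applyOn_one (e : K ↪ W) : applyOn e (1 : QOperator K) = 1 := by
  rw [← Matrix.diagonal_one, applyOn_diagonal, ← Matrix.diagonal_one]

theorem applyOn_conjTranspose (e : K ↪ W) (V : QOperator K) :
    (applyOn e V)ᴴ = applyOn e Vᴴ := by
  classical
  ext x y
  rw [Matrix.conjTranspose_apply, applyOn_eq_applyFamily, applyOn_eq_applyFamily]
  by_cases h : AgreeOff e y x
  · simp [applyFamily, h, h.symm]
  · have h' : ¬ AgreeOff e x y := fun h' => h h'.symm
    simp [applyFamily, h, h']

theorem applyOn_mem_unitaryGroup (e : K ↪ W) {V : QOperator K}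
    (hV : V ∈ Matrix.unitaryGroup (K → Fin 2) ℂ) :
    applyOn e V ∈ Matrix.unitaryGroup (W → Fin 2) ℂ := by
  rw [Matrix.mem_unitaryGroup_iff, Matrix.star_eq_conjTranspose] at hV ⊢
  rw [applyOn_conjTranspose, applyOn_mul, hV, applyOn_one]

end Register

/-! ### Concatenation and unitarity of circuits -/

namespace QueryCircuit

variable {Q W : Type} [Fintype W] [DecidableEq W]

theorem toOperator_append (U : QOperator Q) (c c' : QueryCircuit Q W) :
    toOperator U (c ++ c') = toOperator U c' * toOperator U c := by
  induction c with
  | nil => simp [toOperator]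
  | cons s c ih => simp only [List.cons_append, toOperator, ih, Matrix.mul_assoc]

theorem queryCount_append (c c' : QueryCircuit Q W) :
    queryCount (c ++ c') = queryCount c + queryCount c' := by
  induction c with
  | nil => simp [queryCount]
  | cons s c ih => cases s <;> simp only [List.cons_append, queryCount, ih, add_right_comm]

theorem gateCount_append (c c' : QueryCircuit Q W) :
    gateCount (c ++ c') = gateCount c + gateCount c' := by
  induction c with
  | nil => simp [gateCount]
  | cons s c ih => cases s <;> simp only [List.cons_append, gateCount, ih] <;> omega

theorem toOperator_mem_unitaryGroup [Fintype Q] [DecidableEq Q] {U : QOperator Q}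
    (hU : U ∈ Matrix.unitaryGroup (Q → Fin 2) ℂ) (c : QueryCircuit Q W) :
    toOperator U c ∈ Matrix.unitaryGroup (W → Fin 2) ℂ := by
  induction c with
  | nil => exact one_mem _
  | cons s c ih =>
    refine mul_mem ih ?_
    have hU' : Uᴴ ∈ Matrix.unitaryGroup (Q → Fin 2) ℂ := Unitary.star_mem hU
    cases s with
    | gate k hk e V => exact applyOn_mem_unitaryGroup e V.2
    | query e => exact applyOn_mem_unitaryGroup e hU
    | queryInv e => exact applyOn_mem_unitaryGroup e hU'

end QueryCircuit

/-! ### Query-free circuits, diagonal gates and Hadamard gates -/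

section Gates

/-- `M` is implemented by a circuit of at most `k` elementary gates, without queries. -/
def GateImplementable (Q : Type) {W : Type} [Fintype W] [DecidableEq W] (k : ℕ)
    (M : QOperator W) : Prop :=
  ∃ c : QueryCircuit Q W, c.queryCount = 0 ∧ c.gateCount ≤ k ∧ ∀ U, c.toOperator U = M

variable {Q W : Type} [Fintype W] [DecidableEq W]

theorem GateImplementable.mul {k l : ℕ} {M N : QOperator W} (hM : GateImplementable Q k M)
    (hN : GateImplementable Q l N) : GateImplementable Q (k + l) (M * N) := by
  obtain ⟨c, hc, hc', hcM⟩ := hM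
  obtain ⟨d, hd, hd', hdN⟩ := hN
  refine ⟨d ++ c, ?_, ?_, fun U => ?_⟩
  · rw [QueryCircuit.queryCount_append, hc, hd]
  · rw [QueryCircuit.gateCount_append]; omega
  · rw [QueryCircuit.toOperator_append, hcM, hdN]

theorem GateImplementable.mono {k l : ℕ} {M : QOperator W} (hM : GateImplementable Q k M)
    (h : k ≤ l) : GateImplementable Q l M := by
  obtain ⟨c, hc, hc', hcM⟩ := hM
  exact ⟨c, hc, hc'.trans h, hcM⟩

theorem GateImplementable.of_gate {k : ℕ} (hk : k = 1 ∨ k = 2) (e : Fin k ↪ W)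
    {V : QOperator (Fin k)} (hV : V ∈ Matrix.unitaryGroup (Fin k → Fin 2) ℂ) :
    GateImplementable Q 1 (applyOn e V) :=
  ⟨[.gate k hk e ⟨V, hV⟩], rfl, le_rfl, fun _ => Matrix.one_mul _⟩

theorem diagonal_mem_unitaryGroup {ι : Type} [Fintype ι] [DecidableEq ι] {g : ι → ℂ}
    (hg : ∀ x, ‖g x‖ = 1) : Matrix.diagonal g ∈ Matrix.unitaryGroup ι ℂ := by
  rw [Matrix.mem_unitaryGroup_iff, Matrix.star_eq_conjTranspose, Matrix.diagonal_conjTranspose,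
    Matrix.diagonal_mul_diagonal, ← Matrix.diagonal_one]
  congr 1
  funext x
  have := Complex.mul_conj (g x)
  rw [Complex.normSq_eq_norm_sq, hg x] at this
  simpa using this

/-- The embedding selecting the single qubit `w`. -/
def wire (w : W) : Fin 1 ↪ W := ⟨fun _ => w, fun _ _ _ => Subsingleton.elim _ _⟩

@[simp]
theorem wire_apply (w : W) (i : Fin 1) : wire w i = w := rfl

/-- The embedding selecting two distinct qubits. -/
def wires {v w : W} (h : v ≠ w) : Fin 2 ↪ W :=
  ⟨![v, w], by
    intro i j hij
    fin_cases i <;> fin_cases j <;> first | rfl | exact absurd hij h | exact absurd hij.symm h⟩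

theorem gateImplementable_diagonal_one (w : W) {g : Fin 2 → ℂ} (hg : ∀ b, ‖g b‖ = 1) :
    GateImplementable Q 1 (Matrix.diagonal fun x : W → Fin 2 => g (x w)) := by
  have := GateImplementable.of_gate (Q := Q) (Or.inl rfl) (wire w)
    (diagonal_mem_unitaryGroup (g := fun u : Fin 1 → Fin 2 => g (u 0)) fun u => hg _)
  rwa [applyOn_diagonal] at this

theorem gateImplementable_diagonal_two {v w : W} (h : v ≠ w) {g : Fin 2 → Fin 2 → ℂ}
    (hg : ∀ b b', ‖g b b'‖ = 1) :
    GateImplementable Q 1 (Matrix.diagonal fun x : W → Fin 2 => g (x v) (x w)) := by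
  have := GateImplementable.of_gate (Q := Q) (Or.inr rfl) (wires h)
    (diagonal_mem_unitaryGroup (g := fun u : Fin 2 → Fin 2 => g (u 0) (u 1)) fun u => hg _ _)
  rwa [applyOn_diagonal] at this

/-- The sign `(-1) ^ (b * b')`. -/
def bitSign (b b' : Fin 2) : ℂ := if b = 1 ∧ b' = 1 then -1 else 1

/-- The Hadamard matrix on one qubit. -/
noncomputable def hadamardMatrix : QOperator (Fin 1) :=
  fun u v => ((√2 : ℝ) : ℂ)⁻¹ * bitSign (u 0) (v 0)

/-- The Hadamard gate on the qubit `w`. -/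
noncomputable def hadamardOn (w : W) : QOperator W := applyOn (wire w) hadamardMatrix

theorem inv_sqrt_two_mul_self : (((√2 : ℝ) : ℂ)⁻¹) * ((√2 : ℝ) : ℂ)⁻¹ = 1 / 2 := by
  rw [← mul_inv, ← Complex.ofReal_mul, Real.mul_self_sqrt (by norm_num)]
  norm_num

theorem sum_fin_one_fun (f : (Fin 1 → Fin 2) → ℂ) : ∑ u, f u = f (fun _ => 0) + f (fun _ => 1) := by
  rw [← (Equiv.funUnique (Fin 1) (Fin 2)).symm.sum_comp, Fin.sum_univ_two]
  rfl

theorem hadamardMatrix_mem : hadamardMatrix ∈ Matrix.unitaryGroup (Fin 1 → Fin 2) ℂ := by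
  rw [Matrix.mem_unitaryGroup_iff, Matrix.star_eq_conjTranspose]
  ext u v
  rw [Matrix.mul_apply, sum_fin_one_fun]
  simp only [hadamardMatrix, Matrix.conjTranspose_apply]
  have hu : u = fun _ => u 0 := by funext i; rw [Subsingleton.elim i 0]
  have hv : v = fun _ => v 0 := by funext i; rw [Subsingleton.elim i 0]
  have h2 := inv_sqrt_two_mul_self
  have hs : star (((√2 : ℝ) : ℂ)⁻¹) = ((√2 : ℝ) : ℂ)⁻¹ := by simp
  rw [hu, hv]
  generalize u 0 = a
  generalize v 0 = b
  rw [star_mul', star_mul', hs]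
  fin_cases a <;> fin_cases b <;> (simp [bitSign, funext_iff]; try linear_combination 2 * h2)

theorem gateImplementable_hadamardOn (w : W) : GateImplementable Q 1 (hadamardOn w) :=
  GateImplementable.of_gate (Or.inl rfl) _ hadamardMatrix_mem

theorem extend_wire (w : W) (u : Fin 1 → Fin 2) (y : W → Fin 2) :
    Function.extend (wire w) u y = Function.update y w (u 0) := by
  funext v
  by_cases h : v = w
  · subst h
    rw [Function.update_self]
    exact (wire v).injective.extend_apply u y 0
  · rw [Function.update_of_ne h]
    refine Function.extend_apply' _ _ _ ?_
    rintro ⟨k, hk⟩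
    exact h hk.symm

theorem mul_hadamardOn_apply (M : QOperator W) (w : W) (x y : W → Fin 2) :
    (M * hadamardOn w) x y = ((√2 : ℝ) : ℂ)⁻¹ *
      ∑ b, M x (Function.update y w b) * bitSign b (y w) := by
  classical
  rw [Matrix.mul_apply]
  have key : ∀ z, M x z * hadamardOn w z y =
      if AgreeOff (wire w) z y then M x z * (((√2 : ℝ) : ℂ)⁻¹ * bitSign (z w) (y w)) else 0 := by
    intro z
    rw [hadamardOn, applyOn_eq_applyFamily]
    by_cases hz : AgreeOff (wire w) z y <;> simp [applyFamily, hz, hadamardMatrix]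
  rw [Finset.sum_congr rfl fun z _ => key z]
  refine (sum_ite_agreeOff (wire w) y
    fun z => M x z * (((√2 : ℝ) : ℂ)⁻¹ * bitSign (z w) (y w))).trans ?_
  rw [sum_fin_one_fun, Fin.sum_univ_two]
  simp only [extend_wire, Function.update_self]
  ring

theorem hadamardOn_mul_apply (M : QOperator W) (w : W) (x y : W → Fin 2) :
    (hadamardOn w * M) x y = ((√2 : ℝ) : ℂ)⁻¹ *
      ∑ b, bitSign (x w) b * M (Function.update x w b) y := by
  classical
  rw [Matrix.mul_apply]
  have key : ∀ z, hadamardOn w x z * M z y =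
      if AgreeOff (wire w) z x then (((√2 : ℝ) : ℂ)⁻¹ * bitSign (x w) (z w)) * M z y else 0 := by
    intro z
    rw [hadamardOn, applyOn_eq_applyFamily]
    by_cases hz : AgreeOff (wire w) z x
    · simp [applyFamily, hz, hz.symm, hadamardMatrix]
    · have : ¬ AgreeOff (wire w) x z := fun h => hz h.symm
      simp [applyFamily, hz, this]
  rw [Finset.sum_congr rfl fun z _ => key z]
  refine (sum_ite_agreeOff (wire w) x
    fun z => (((√2 : ℝ) : ℂ)⁻¹ * bitSign (x w) (z w)) * M z y).trans ?_
  rw [sum_fin_one_fun, Fin.sum_univ_two]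
  simp only [extend_wire, Function.update_self]
  ring

theorem hadamardOn_conj_apply (M : QOperator W) (w : W) (x y : W → Fin 2) :
    (hadamardOn w * M * hadamardOn w) x y = 1 / 2 *
      ∑ b, ∑ b', bitSign (x w) b * bitSign b' (y w) *
        M (Function.update x w b) (Function.update y w b') := by
  rw [mul_hadamardOn_apply, ← inv_sqrt_two_mul_self]
  simp only [hadamardOn_mul_apply, Fin.sum_univ_two]
  ring

end Gates

/-! ### Multiply controlled flips from Toffoli ladders with borrowed qubits -/

section Flips

/-- The matrix that maps the basis vector `y` to the basis vector `f y`. -/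
noncomputable def functionMatrix {ι : Type} [DecidableEq ι] (f : ι → ι) : Matrix ι ι ℂ :=
  fun x y => if x = f y then 1 else 0

theorem functionMatrix_mul {ι : Type} [Fintype ι] [DecidableEq ι] (f g : ι → ι) :
    functionMatrix f * functionMatrix g = functionMatrix (f ∘ g) := by
  ext x y
  simp [functionMatrix, Matrix.mul_apply]

theorem functionMatrix_conj_diagonal {ι : Type} [Fintype ι] [DecidableEq ι] {f : ι → ι}
    (hf : ∀ x, f (f x) = x) (g : ι → ℂ) :
    functionMatrix f * Matrix.diagonal g * functionMatrix f = Matrix.diagonal (g ∘ f) := by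
  have hinj : Function.Injective f := Function.LeftInverse.injective hf
  ext x y
  have h : ∀ z, x = f z ↔ z = f x := fun z =>
    ⟨fun h => by rw [h, hf], fun h => by rw [h, hf]⟩
  rw [Matrix.mul_apply]
  by_cases hxy : x = y
  · subst hxy
    simp [functionMatrix, Matrix.diagonal_apply, h, Matrix.mul_apply]
  · simp [functionMatrix, Matrix.diagonal_apply, h, hinj.eq_iff, hxy, Ne.symm hxy,
      Matrix.mul_apply]

variable {W : Type} [DecidableEq W]

/-- The predicate `P` does not depend on the qubit `t`. -/
def IndepOf (P : (W → Fin 2) → Prop) (t : W) : Prop :=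
  ∀ x b, P (Function.update x t b) ↔ P x

theorem indepOf_eq_zero {c t : W} (h : c ≠ t) : IndepOf (fun x => x c = 0) t := by
  intro x b
  simp [Function.update_of_ne h]

theorem IndepOf.and {P P' : (W → Fin 2) → Prop} {t : W} (h : IndepOf P t) (h' : IndepOf P' t) :
    IndepOf (fun x => P x ∧ P' x) t := fun x b => and_congr (h x b) (h' x b)

theorem IndepOf.all {ι : Type} {p : ι → Prop} {P : ι → (W → Fin 2) → Prop} {t : W}
    (h : ∀ i, p i → IndepOf (P i) t) : IndepOf (fun x => ∀ i, p i → P i x) t :=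
  fun x b => forall_congr' fun i => forall_congr' fun hi => h i hi x b

theorem indepOf_true (t : W) : IndepOf (fun _ => True) t := fun _ _ => Iff.rfl

open Classical in
/-- The map on basis states that flips the qubit `t` if `P` holds. -/
noncomputable def controlledFlip (P : (W → Fin 2) → Prop) (t : W) (x : W → Fin 2) : W → Fin 2 :=
  if P x then Function.update x t (x t + 1) else x

theorem controlledFlip_of {P : (W → Fin 2) → Prop} {t : W} {x : W → Fin 2} (h : P x) :
    controlledFlip P t x = Function.update x t (x t + 1) := if_pos h

theorem controlledFlip_of_not {P : (W → Fin 2) → Prop} {t : W} {x : W → Fin 2} (h : ¬ P x) :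
    controlledFlip P t x = x := if_neg h

theorem controlledFlip_congr {P P' : (W → Fin 2) → Prop} (h : ∀ x, P x ↔ P' x) (t : W) :
    controlledFlip P t = controlledFlip P' t := by
  rw [show P = P' from funext fun x => propext (h x)]

theorem fin_two_add_one_add_one (b : Fin 2) : b + 1 + 1 = b := by
  fin_cases b <;> rfl

theorem fin_two_eq (b : Fin 2) : b = 0 ∨ b = 1 := by
  fin_cases b <;> simp

theorem IndepOf.controlledFlip_iff {P P' : (W → Fin 2) → Prop} {t : W} (h : IndepOf P' t)
    (x : W → Fin 2) : P' (controlledFlip P t x) ↔ P' x := by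
  by_cases hx : P x
  · rw [controlledFlip_of hx, h]
  · rw [controlledFlip_of_not hx]

theorem controlledFlip_self {P : (W → Fin 2) → Prop} {t : W} (h : IndepOf P t) (x : W → Fin 2) :
    controlledFlip P t (controlledFlip P t x) = x := by
  by_cases hx : P x
  · have h' : P (controlledFlip P t x) := (h.controlledFlip_iff x).2 hx
    rw [controlledFlip_of h', controlledFlip_of hx]
    simp [fin_two_add_one_add_one]
  · rw [controlledFlip_of_not hx, controlledFlip_of_not hx]

theorem controlledFlip_comm {P P' : (W → Fin 2) → Prop} {t t' : W} (h : IndepOf P t')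
    (h' : IndepOf P' t) (htt : t ≠ t') (x : W → Fin 2) :
    controlledFlip P t (controlledFlip P' t' x) = controlledFlip P' t' (controlledFlip P t x) := by
  have h1 := h.controlledFlip_iff (P := P') x
  have h2 := h'.controlledFlip_iff (P := P) x
  by_cases hx : P x <;> by_cases hx' : P' x
  · rw [controlledFlip_of (h1.2 hx), controlledFlip_of (h2.2 hx'), controlledFlip_of hx,
      controlledFlip_of hx', Function.update_of_ne htt, Function.update_of_ne htt.symm,
      Function.update_comm htt]
  · rw [controlledFlip_of_not hx', controlledFlip_of_not (P := P') (mt h2.1 hx')]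
  · rw [controlledFlip_of_not hx, controlledFlip_of_not (P := P) (mt h1.1 hx)]
  · rw [controlledFlip_of_not hx', controlledFlip_of_not hx, controlledFlip_of_not hx']

/-- Conjugating a flip of the control qubit `w` by a flip of `t` controlled on `w`. -/
theorem controlledFlip_conj {P F : (W → Fin 2) → Prop} {w t : W} (hw : w ≠ t)
    (hPt : IndepOf P t) (hPw : IndepOf P w) (hFt : IndepOf F t) (hFw : IndepOf F w)
    (x : W → Fin 2) :
    controlledFlip (fun x => F x ∧ x w = 0) t (controlledFlip P w
      (controlledFlip (fun x => F x ∧ x w = 0) t x)) =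
    controlledFlip (fun x => P x ∧ F x) t (controlledFlip P w x) := by
  have hGt : IndepOf (fun x : W → Fin 2 => F x ∧ x w = 0) t := hFt.and (indepOf_eq_zero hw)
  by_cases hP : P x
  · have h1 : P (controlledFlip (fun x => F x ∧ x w = 0) t x) := (hPt.controlledFlip_iff x).2 hP
    have h2 : P (controlledFlip P w x) := (hPw.controlledFlip_iff x).2 hP
    by_cases hF : F x
    · have h3 : F (controlledFlip P w x) := (hFw.controlledFlip_iff x).2 hF
      rw [controlledFlip_of (P := fun x => P x ∧ F x) ⟨h2, h3⟩, controlledFlip_of h1]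
      rw [controlledFlip_of hP] at h3 ⊢
      by_cases hx : x w = 0
      · rw [controlledFlip_of (P := fun x => F x ∧ x w = 0) ⟨hF, hx⟩]
        rw [controlledFlip_of_not]
        · rw [Function.update_of_ne hw, Function.update_of_ne hw.symm, Function.update_comm hw]
        · simp [Function.update_of_ne hw, hx]
      · have hx1 : x w = 1 := Fin.eq_one_of_ne_zero _ hx
        rw [controlledFlip_of_not (P := fun x => F x ∧ x w = 0) (fun h => hx h.2)]
        rw [controlledFlip_of ⟨h3, by simp [hx1]⟩]
    · have h3 : ¬ F (controlledFlip P w x) := mt (hFw.controlledFlip_iff x).1 hF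
      rw [controlledFlip_of_not (P := fun x => P x ∧ F x) fun h => h3 h.2,
        controlledFlip_of_not (P := fun x => F x ∧ x w = 0) (x := x) fun h => hF h.1,
        controlledFlip_of_not fun h => h3 h.1]
  · have h1 : ¬ P (controlledFlip (fun x => F x ∧ x w = 0) t x) :=
      mt (hPt.controlledFlip_iff x).1 hP
    rw [controlledFlip_of_not h1, controlledFlip_self hGt, controlledFlip_of_not hP,
      controlledFlip_of_not fun h => hP h.1]

/-- The palindromic ladder of Toffoli gates on the controls `c` and the targets `w`. -/
noncomputable def flipLadder (c w : ℕ → W) : ℕ → (W → Fin 2) → (W → Fin 2)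
  | 0 => controlledFlip (fun x => x (c 0) = 0) (w 0)
  | j + 1 => controlledFlip (fun x => x (c (j + 1)) = 0 ∧ x (w j) = 0) (w (j + 1)) ∘
      flipLadder c w j ∘ controlledFlip (fun x => x (c (j + 1)) = 0 ∧ x (w j) = 0) (w (j + 1))

/-- The flip of `w j` controlled on `c 0, …, c j`. -/
noncomputable def multiFlip (c w : ℕ → W) (j : ℕ) : (W → Fin 2) → (W → Fin 2) :=
  controlledFlip (fun x => ∀ i, i ≤ j → x (c i) = 0) (w j)

variable {c w : ℕ → W} {k : ℕ}

/-- The ladder neither reads nor writes `w l`, and `P` does not read the qubits the ladder writes.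
-/
theorem flipLadder_comm (hcw : ∀ i j, i ≤ k → j ≤ k → c i ≠ w j) {j l : ℕ} (hl : l ≤ k)
    (hjl : j < l) {P : (W → Fin 2) → Prop} (hw : ∀ i, i < l → w i ≠ w l)
    (hP : ∀ i, i ≤ j → IndepOf P (w i)) (x : W → Fin 2) :
    flipLadder c w j (controlledFlip P (w l) x) = controlledFlip P (w l) (flipLadder c w j x) := by
  induction j generalizing x with
  | zero =>
    exact controlledFlip_comm (indepOf_eq_zero (hcw _ _ (by omega) (by omega))) (hP 0 le_rfl)
      (hw 0 hjl) x
  | succ j ih =>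
    have ih' := ih (by omega) fun i hi => hP i (by omega)
    have key := controlledFlip_comm (P := fun x => x (c (j + 1)) = 0 ∧ x (w j) = 0)
      ((indepOf_eq_zero (hcw (j + 1) l (by omega) (by omega))).and
        (indepOf_eq_zero (hw j (by omega)))) (hP (j + 1) le_rfl) (hw (j + 1) (by omega))
    simp only [flipLadder, Function.comp_apply]
    rw [key, ih', key]

/-- The ladder flips every `w i` controlled on `c 0, …, c i`, not only the last target. The
induction conjugates one multiple flip by the outer Toffoli gate, after commuting that gate past the
shorter ladder. -/
theorem flipLadder_succ (hcw : ∀ i j, i ≤ k → j ≤ k → c i ≠ w j)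
    (hw : ∀ i j, i ≤ k → j ≤ k → i ≠ j → w i ≠ w j) {j : ℕ} (hj : j + 1 ≤ k) (x : W → Fin 2) :
    flipLadder c w (j + 1) x = multiFlip c w (j + 1) (flipLadder c w j x) := by
  have main : ∀ j, j + 1 ≤ k → ∀ x,
      controlledFlip (fun x => x (c (j + 1)) = 0 ∧ x (w j) = 0) (w (j + 1)) (multiFlip c w j
        (controlledFlip (fun x => x (c (j + 1)) = 0 ∧ x (w j) = 0) (w (j + 1)) x)) =
      multiFlip c w (j + 1) (multiFlip c w j x) := by
    intro j hj x
    rw [multiFlip, controlledFlip_conj (hw _ _ (by omega) (by omega) (by omega))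
      (IndepOf.all fun i hi => indepOf_eq_zero (hcw _ _ (by omega) (by omega)))
      (IndepOf.all fun i hi => indepOf_eq_zero (hcw _ _ (by omega) (by omega)))
      (indepOf_eq_zero (hcw _ _ (by omega) (by omega)))
      (indepOf_eq_zero (hcw _ _ (by omega) (by omega))), multiFlip]
    refine congrFun (controlledFlip_congr (fun y => ?_) _) _
    constructor
    · rintro ⟨h1, h2⟩ i hi
      rcases Nat.lt_or_ge j i with h | h
      · rwa [show i = j + 1 by omega]
      · exact h1 i h
    · exact fun h => ⟨fun i hi => h i (by omega), h _ le_rfl⟩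
  induction j generalizing x with
  | zero =>
    have h0 : flipLadder c w 0 = multiFlip c w 0 := controlledFlip_congr (fun x => by simp) _
    rw [h0, ← main 0 hj x, ← h0]
    rfl
  | succ j ih =>
    rw [flipLadder, Function.comp_apply, Function.comp_apply, ih (by omega),
      flipLadder_comm hcw hj (by omega) (fun i hi => hw _ _ (by omega) (by omega) (by omega)),
      main _ hj, ← ih (by omega)]
    intro i hi
    exact (indepOf_eq_zero (hcw _ _ (by omega) (by omega))).and
      (indepOf_eq_zero (hw _ _ (by omega) (by omega) (by omega)))

theorem flipLadder_self (hcw : ∀ i j, i ≤ k → j ≤ k → c i ≠ w j)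
    (hw : ∀ i j, i ≤ k → j ≤ k → i ≠ j → w i ≠ w j) {j : ℕ} (hj : j ≤ k) (x : W → Fin 2) :
    flipLadder c w j (flipLadder c w j x) = x := by
  induction j generalizing x with
  | zero => exact controlledFlip_self (indepOf_eq_zero (hcw _ _ (by omega) (by omega))) x
  | succ j ih =>
    have h : IndepOf (fun x => x (c (j + 1)) = 0 ∧ x (w j) = 0) (w (j + 1)) :=
      (indepOf_eq_zero (hcw _ _ (by omega) (by omega))).and
        (indepOf_eq_zero (hw _ _ (by omega) (by omega) (by omega)))
    simp only [flipLadder, Function.comp_apply]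
    rw [controlledFlip_self h, ih (by omega), controlledFlip_self h]

/-- The shorter ladder is an involution, so running it first cancels the unwanted flips and returns
the borrowed qubits to their arbitrary initial values. -/
theorem multiFlip_succ_eq (hcw : ∀ i j, i ≤ k → j ≤ k → c i ≠ w j)
    (hw : ∀ i j, i ≤ k → j ≤ k → i ≠ j → w i ≠ w j) {j : ℕ} (hj : j + 1 ≤ k) :
    multiFlip c w (j + 1) = flipLadder c w (j + 1) ∘ flipLadder c w j := by
  funext x
  rw [Function.comp_apply, flipLadder_succ hcw hw hj, flipLadder_self hcw hw (by omega)]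

end Flips

/-! ### Gate counts for controlled flips -/

section FlipGates

variable {Q W : Type} [Fintype W] [DecidableEq W]

/-- This is `H Z H = X` under the control `P`; flips thus reduce to diagonal gates. -/
theorem hadamardOn_conj_diagonal {P : (W → Fin 2) → Prop} [DecidablePred P] {t : W} (h : IndepOf P t) :
    hadamardOn t * Matrix.diagonal (fun x => if P x ∧ x t = 1 then (-1 : ℂ) else 1) *
      hadamardOn t = functionMatrix (controlledFlip P t) := by
  ext x y
  rw [hadamardOn_conj_apply]
  by_cases hxy : ∃ a, x = Function.update y t a
  · obtain ⟨a, rfl⟩ := hxy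
    have hinj : ∀ b b', Function.update y t b = Function.update y t b' ↔ b = b' :=
      fun b b' => (Function.update_injective y t).eq_iff
    have hy : ∀ b, Function.update y t b = y ↔ b = y t := fun b => by
      conv_lhs => rw [← Function.update_eq_self t y]
      simp
    have hP : ∀ b, P (Function.update y t b) ↔ P y := fun b => h y b
    simp only [Function.update_idem, Function.update_self, Matrix.diagonal_apply, hinj, hP,
      functionMatrix, controlledFlip, Fin.sum_univ_two]
    by_cases hPy : P y
    · simp only [hPy, if_true, hinj]
      rcases fin_two_eq (y t) with hb | hb <;> rcases fin_two_eq a with ha | ha <;>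
        simp [hb, ha, bitSign] <;> norm_num
    · simp only [hPy, if_false, hy]
      rcases fin_two_eq (y t) with hb | hb <;> rcases fin_two_eq a with ha | ha <;>
        simp [hb, ha, bitSign] <;> norm_num
  · have h1 : ∀ b b', Function.update x t b ≠ Function.update y t b' := by
      intro b b' hb
      refine hxy ⟨x t, ?_⟩
      rw [← Function.update_idem (a := t) b' (x t) y, ← hb]
      simp
    have h2 : x ≠ controlledFlip P t y := by
      by_cases hP : P y
      · rw [controlledFlip_of hP]
        exact fun h' => hxy ⟨_, h'⟩
      · rw [controlledFlip_of_not hP]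
        exact fun h' => hxy ⟨y t, by simp [h']⟩
    simp [Matrix.diagonal_apply_ne _ (h1 _ _), functionMatrix, h2]

theorem gateImplementable_flip (t : W) :
    GateImplementable Q 3 (functionMatrix (controlledFlip (fun _ : W → Fin 2 => True) t)) := by
  rw [← hadamardOn_conj_diagonal (indepOf_true t)]
  refine (GateImplementable.mul (k := 2) (GateImplementable.mul (k := 1) (l := 1)
    (gateImplementable_hadamardOn t) ?_) (gateImplementable_hadamardOn t))
  refine (gateImplementable_diagonal_one t (g := fun b => if True ∧ b = 1 then -1 else 1) ?_)
  intro b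
  fin_cases b <;> simp

theorem gateImplementable_cnot {c t : W} (h : c ≠ t) :
    GateImplementable Q 3 (functionMatrix (controlledFlip (fun x : W → Fin 2 => x c = 0) t)) := by
  rw [← hadamardOn_conj_diagonal (indepOf_eq_zero h)]
  refine (GateImplementable.mul (k := 2) (GateImplementable.mul (k := 1) (l := 1)
    (gateImplementable_hadamardOn t) ?_) (gateImplementable_hadamardOn t))
  refine (gateImplementable_diagonal_two h (g := fun b b' => if b = 0 ∧ b' = 1 then -1 else 1) ?_)
  intro b b'
  fin_cases b <;> fin_cases b' <;> simp

theorem gateImplementable_toffoli {a b t : W} (hab : a ≠ b) (hat : a ≠ t) (hbt : b ≠ t) :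
    GateImplementable Q 11
      (functionMatrix (controlledFlip (fun x : W → Fin 2 => x a = 0 ∧ x b = 0) t)) := by
  rw [← hadamardOn_conj_diagonal ((indepOf_eq_zero hat).and (indepOf_eq_zero hbt))]
  refine GateImplementable.mul (k := 10) (GateImplementable.mul (k := 1) (l := 9)
    (gateImplementable_hadamardOn t) ?_) (gateImplementable_hadamardOn t)
  -- Controls fire on the value `0`. The phases multiply as `s(b, t) · s(b', t)⁻¹ · s(a, t)`, where
  -- `b'` is `b` flipped if `a = 0`. This is `I² = -1` when `a = b = 0`, `t = 1`, and `1` otherwise.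
  let s : Fin 2 → Fin 2 → ℂ := fun b b' => if b = 0 ∧ b' = 1 then Complex.I else 1
  have hs : ∀ b b', ‖s b b'‖ = 1 := by
    intro b b'
    fin_cases b <;> fin_cases b' <;> simp [s]
  have hs' : ∀ b b', ‖(s b b')⁻¹‖ = 1 := by
    intro b b'
    rw [norm_inv, hs, inv_one]
  have hX := gateImplementable_cnot (Q := Q) hab
  have h1 := gateImplementable_diagonal_two (Q := Q) hbt hs
  have h2 := gateImplementable_diagonal_two (Q := Q) hbt hs'
  have h3 := gateImplementable_diagonal_two (Q := Q) hat hs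
  have key := (h1.mul ((hX.mul h2).mul hX)).mul h3
  rw [functionMatrix_conj_diagonal (fun x => controlledFlip_self (indepOf_eq_zero hab) x),
    Matrix.diagonal_mul_diagonal, Matrix.diagonal_mul_diagonal] at key
  refine cast (congrArg (fun g => GateImplementable Q 9 (Matrix.diagonal g))
    (funext fun x => ?_)) key
  symm
  by_cases ha : x a = 0
  · rw [Function.comp_apply, controlledFlip_of ha, Function.update_self,
      Function.update_of_ne hbt.symm]
    simp only [ha]
    rcases fin_two_eq (x b) with hb | hb <;> rcases fin_two_eq (x t) with ht | ht <;>
      simp [s, hb, ht]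
  · rw [Function.comp_apply, controlledFlip_of_not (P := fun x : W → Fin 2 => x a = 0) ha,
      Fin.eq_one_of_ne_zero _ ha]
    rcases fin_two_eq (x b) with hb | hb <;> rcases fin_two_eq (x t) with ht | ht <;>
      simp [s, hb, ht]

theorem gateImplementable_flipLadder {c w : ℕ → W} {k : ℕ}
    (hcw : ∀ i j, i ≤ k → j ≤ k → c i ≠ w j)
    (hw : ∀ i j, i ≤ k → j ≤ k → i ≠ j → w i ≠ w j) {j : ℕ} (hj : j ≤ k) :
    GateImplementable Q (22 * j + 3) (functionMatrix (flipLadder c w j)) := by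
  induction j with
  | zero => exact gateImplementable_cnot (hcw _ _ (by omega) (by omega))
  | succ j ih =>
    have h := gateImplementable_toffoli (Q := Q) (hcw (j + 1) j (by omega) (by omega))
      (hcw (j + 1) (j + 1) (by omega) (by omega)) (hw j (j + 1) (by omega) (by omega) (by omega))
    have := h.mul ((ih (by omega)).mul h)
    rw [functionMatrix_mul, functionMatrix_mul] at this
    exact this.mono (by omega)

theorem gateImplementable_multiFlip {c w : ℕ → W} {k : ℕ}
    (hcw : ∀ i j, i ≤ k → j ≤ k → c i ≠ w j)
    (hw : ∀ i j, i ≤ k → j ≤ k → i ≠ j → w i ≠ w j) :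
    GateImplementable Q (44 * k + 3) (functionMatrix (multiFlip c w k)) := by
  cases k with
  | zero =>
    rw [show multiFlip c w 0 = flipLadder c w 0 from controlledFlip_congr (fun x => by simp) _]
    exact gateImplementable_flipLadder hcw hw le_rfl
  | succ k =>
    rw [multiFlip_succ_eq hcw hw le_rfl, ← functionMatrix_mul]
    exact ((gateImplementable_flipLadder hcw hw le_rfl).mul
      (gateImplementable_flipLadder hcw hw (Nat.le_succ k))).mono (by omega)

/-- A flip of `t` with `k` controls and `k - 1` borrowed qubits `w`. -/
theorem gateImplementable_controlledFlip_all {c w : ℕ → W} {t : W} (k : ℕ)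
    (hc : ∀ i, i < k → c i ≠ t) (hwt : ∀ i, i + 1 < k → w i ≠ t)
    (hcw : ∀ i j, i < k → j + 1 < k → c i ≠ w j)
    (hw : ∀ i j, i + 1 < k → j + 1 < k → i ≠ j → w i ≠ w j) :
    GateImplementable Q (44 * k + 3)
      (functionMatrix (controlledFlip (fun x => ∀ i, i < k → x (c i) = 0) t)) := by
  cases k with
  | zero =>
    rw [controlledFlip_congr (P' := fun _ => True) (fun x => by simp)]
    exact gateImplementable_flip t
  | succ k =>
    have := gateImplementable_multiFlip (Q := Q) (c := c) (w := fun i => if i < k then w i else t)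
      (k := k) ?_ ?_
    · rw [multiFlip, if_neg (lt_irrefl k)] at this
      rw [controlledFlip_congr (P' := fun x => ∀ i, i ≤ k → x (c i) = 0)
        (fun x => by simp only [Nat.lt_succ_iff])]
      exact this.mono (by omega)
    · intro i j hi hj
      split_ifs with h
      · exact hcw i j (by omega) (by omega)
      · exact hc i (by omega)
    · intro i j hi hj hij
      split_ifs with h h' h'
      · exact hw i j (by omega) (by omega) hij
      · exact hwt i (by omega)
      · exact (hwt j (by omega)).symm
      · omega

end FlipGates

/-! ### The sign-controlled phase rotation -/

section SignalGate

/-- The eigenvalue `±1` of the Pauli `Z` operator on a computational basis state. -/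
noncomputable def zSign (b : Fin 2) : ℝ := if b = 0 then 1 else -1

theorem zSign_add_one (b : Fin 2) : zSign (b + 1) = -zSign b := by
  fin_cases b <;> simp [zSign]

/-- The diagonal operator with phases `ζ`. -/
noncomputable def phaseDiagonal {ι : Type} [DecidableEq ι] (ζ : ι → ℝ) : Matrix ι ι ℂ :=
  Matrix.diagonal fun x => Complex.exp (ζ x * Complex.I)

theorem phaseDiagonal_mul {ι : Type} [Fintype ι] [DecidableEq ι] (ζ ξ : ι → ℝ) :
    phaseDiagonal ζ * phaseDiagonal ξ = phaseDiagonal fun x => ζ x + ξ x := by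
  rw [phaseDiagonal, phaseDiagonal, Matrix.diagonal_mul_diagonal, phaseDiagonal]
  congr 1
  funext x
  rw [← Complex.exp_add]
  push_cast
  ring_nf

theorem functionMatrix_conj_phaseDiagonal {ι : Type} [Fintype ι] [DecidableEq ι] {f : ι → ι}
    (hf : ∀ x, f (f x) = x) (ζ : ι → ℝ) :
    functionMatrix f * phaseDiagonal ζ * functionMatrix f = phaseDiagonal fun x => ζ (f x) :=
  functionMatrix_conj_diagonal hf _

variable {Q W : Type} [Fintype W] [DecidableEq W]

theorem gateImplementable_phaseDiagonal_zSign (b : W) (θ : ℝ) :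
    GateImplementable Q 1 (phaseDiagonal fun x : W → Fin 2 => θ * zSign (x b)) :=
  gateImplementable_diagonal_one b
    (g := fun a => Complex.exp ((θ * zSign a : ℝ) * Complex.I))
    fun _ => Complex.norm_exp_ofReal_mul_I _

theorem zSign_controlledFlip {P : (W → Fin 2) → Prop} [DecidablePred P] {t : W} (x : W → Fin 2) :
    zSign (controlledFlip P t x t) = if P x then -zSign (x t) else zSign (x t) := by
  split_ifs with h
  · rw [controlledFlip_of h, Function.update_self, zSign_add_one]
  · rw [controlledFlip_of_not h]

/-- The rotation `exp (i φ Z)` of the qubit `b`, inverted unless all of the qubits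
`anc 0, …, anc (m - 1)` are zero. -/
theorem gateImplementable_controlledRotation {m : ℕ} {anc : ℕ → W} {b : W}
    (hb : ∀ i, i < m → anc i ≠ b) (hanc : ∀ i j, i < m → j < m → i ≠ j → anc i ≠ anc j) (φ : ℝ) :
    GateImplementable Q (200 * (m + 1)) (phaseDiagonal fun x : W → Fin 2 =>
      φ * zSign (x b) * if ∀ i, i < m → x (anc i) = 0 then 1 else -1) := by
  -- A flip with `k` controls borrows `k - 1` qubits, so two nearly equal halves can serve as
  -- workspace for each other.
  obtain ⟨k, l, hkl, hlk, hkl'⟩ : ∃ k l, m = k + l ∧ l ≤ k ∧ k ≤ l + 1 :=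
    ⟨(m + 1) / 2, m / 2, by omega, by omega, by omega⟩
  subst hkl
  let C₁ : (W → Fin 2) → Prop := fun x => ∀ i, i < k → x (anc i) = 0
  let C₂ : (W → Fin 2) → Prop := fun x => ∀ i, i < l → x (anc (k + i)) = 0
  have hi₁ : IndepOf C₁ b := IndepOf.all fun i hi => indepOf_eq_zero (hb i (by omega))
  have hi₂ : IndepOf C₂ b := IndepOf.all fun i hi => indepOf_eq_zero (hb _ (by omega))
  have h₁ : GateImplementable Q (44 * k + 3) (functionMatrix (controlledFlip C₁ b)) :=
    gateImplementable_controlledFlip_all (c := anc) (w := fun i => anc (k + i)) k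
      (fun i hi => hb i (by omega)) (fun i hi => hb _ (by omega))
      (fun i j hi hj => hanc _ _ (by omega) (by omega) (by omega))
      (fun i j hi hj hij => hanc _ _ (by omega) (by omega) (by omega))
  have h₂ : GateImplementable Q (44 * l + 3) (functionMatrix (controlledFlip C₂ b)) :=
    gateImplementable_controlledFlip_all (c := fun i => anc (k + i)) (w := anc) l
      (fun i hi => hb _ (by omega)) (fun i hi => hb _ (by omega))
      (fun i j hi hj => hanc _ _ (by omega) (by omega) (by omega))
      (fun i j hi hj hij => hanc _ _ (by omega) (by omega) (by omega))
  -- Writing `C₂` also for the indicator, the phase is `θ z - θ (1 - 2 C₂) z = 2 θ C₂ z`. Repeating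
  -- the commutator with `C₁` gives `2 φ C₁ C₂ z`, and the additional `-φ z` turns this into `φ z (2
  -- C₁ C₂ - 1)`.
  have hB : ∀ θ : ℝ, GateImplementable Q (88 * l + 8) (phaseDiagonal fun x : W → Fin 2 =>
      θ * zSign (x b) + -θ * zSign (controlledFlip C₂ b x b)) := by
    intro θ
    have := (gateImplementable_phaseDiagonal_zSign (Q := Q) b θ).mul
      ((h₂.mul (gateImplementable_phaseDiagonal_zSign b (-θ))).mul h₂)
    rw [functionMatrix_conj_phaseDiagonal (controlledFlip_self hi₂), phaseDiagonal_mul] at this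
    exact this.mono (by omega)
  have key := (gateImplementable_phaseDiagonal_zSign (Q := Q) b (-φ)).mul
    ((hB (φ / 2)).mul ((h₁.mul (hB (-(φ / 2)))).mul h₁))
  rw [functionMatrix_conj_phaseDiagonal (controlledFlip_self hi₁), phaseDiagonal_mul,
    phaseDiagonal_mul] at key
  refine cast (congrArg (fun ζ => GateImplementable Q _ (phaseDiagonal ζ))
    (funext fun x => ?_)) (key.mono (l := 200 * (k + l + 1)) (by omega))
  classical
  have hC : (∀ i, i < k + l → x (anc i) = 0) ↔ C₁ x ∧ C₂ x := by
    constructor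
    · exact fun h => ⟨fun i hi => h i (by omega), fun i hi => h _ (by omega)⟩
    · rintro ⟨h, h'⟩ i hi
      rcases Nat.lt_or_ge i k with hik | hik
      · exact h i hik
      · have := h' (i - k) (by omega)
        rwa [Nat.add_sub_cancel' hik] at this
  simp only [zSign_controlledFlip, hi₂.controlledFlip_iff, hC]
  by_cases hx₁ : C₁ x <;> by_cases hx₂ : C₂ x <;> (simp [hx₁, hx₂]; try ring)

end SignalGate

/-! ### Alternating phase sequences and their circuits -/

section Alternating

variable {m n : ℕ}

/-- The operator `exp (i φ (2 Π - 1))`, where `Π` projects to the states whose ancilla qubits are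
all zero. -/
noncomputable def ancillaPhase (m n : ℕ) (φ : ℝ) : QOperator (Fin m ⊕ Fin n) :=
  phaseDiagonal fun x => φ * if ∀ i : Fin m, x (Sum.inl i) = 0 then 1 else -1

/-- The alternating phase sequence with first phase `φ₀`; the head of the list is the phase
that is applied last. -/
noncomputable def alternatingSequence (U : QOperator (Fin m ⊕ Fin n)) (φ₀ : ℝ) :
    List ℝ → QOperator (Fin m ⊕ Fin n)
  | [] => ancillaPhase m n φ₀
  | φ :: l => ancillaPhase m n φ * (if Even l.length then U else Uᴴ) * alternatingSequence U φ₀ l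

/-- The embedding of the black-box register that leaves out the first ancilla qubit. -/
def succEmbedding (m n : ℕ) : Fin m ⊕ Fin n ↪ Fin (m + 1) ⊕ Fin n :=
  (Fin.succEmb m).sumMap (Function.Embedding.refl (Fin n))

@[simp]
theorem succEmbedding_inl (i : Fin m) : succEmbedding m n (Sum.inl i) = Sum.inl i.succ := rfl

@[simp]
theorem succEmbedding_inr (i : Fin n) : succEmbedding m n (Sum.inr i) = Sum.inr i := rfl

theorem notMem_range_succEmbedding : Sum.inl 0 ∉ Set.range (succEmbedding m n) := by
  rintro ⟨i | i, hi⟩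
  · simp [Fin.succ_ne_zero] at hi
  · simp at hi

/-- The operator that applies `M β` to the black-box register if the first ancilla is in the
state `β`. -/
noncomputable def branch (M : Fin 2 → QOperator (Fin m ⊕ Fin n)) :
    QOperator (Fin (m + 1) ⊕ Fin n) :=
  applyFamily (succEmbedding m n) fun x => M (x (Sum.inl 0))

theorem branch_mul (M N : Fin 2 → QOperator (Fin m ⊕ Fin n)) :
    branch M * branch N = branch fun β => M β * N β :=
  applyFamily_mul _ _ _ fun x z h => by rw [h _ notMem_range_succEmbedding]

theorem gateImplementable_branch_ancillaPhase {Q : Type} (φ : ℝ) :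
    GateImplementable Q (200 * (m + 1)) (branch fun β => ancillaPhase m n (zSign β * φ)) := by
  let anc : ℕ → Fin (m + 1) ⊕ Fin n :=
    fun i => if h : i < m then Sum.inl (Fin.succ ⟨i, h⟩) else Sum.inl 0
  have hanc : ∀ i (h : i < m), anc i = Sum.inl (Fin.succ ⟨i, h⟩) := fun i h => dif_pos h
  have := gateImplementable_controlledRotation (Q := Q) (m := m) (anc := anc) (b := Sum.inl 0)
    (fun i hi => by simp [hanc i hi])
    (fun i j hi hj hij => by simpa [hanc i hi, hanc j hj] using hij) φ
  refine cast (congrArg (GateImplementable Q _) ?_) this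
  simp only [branch, ancillaPhase, phaseDiagonal]
  rw [applyFamily_diagonal]
  congr 1
  funext x
  have hx : (∀ i, i < m → x (anc i) = 0) ↔
      ∀ i : Fin m, (x ∘ succEmbedding m n) (Sum.inl i) = 0 := by
    constructor
    · intro h i
      simpa [hanc i i.2] using h i i.2
    · intro h i hi
      simpa [hanc i hi] using h ⟨i, hi⟩
  simp only [hx]
  ring_nf

/-- Both branches use `U` and `Uᴴ` in the same order and differ only in the signs of the phases, so
each query acts without control and is made once for both. -/
theorem exists_circuit_alternatingSequence (m n : ℕ) (φ₀ : ℝ) (l : List ℝ) :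
    ∃ c : QueryCircuit (Fin m ⊕ Fin n) (Fin (m + 1) ⊕ Fin n), c.queryCount = l.length ∧
      c.gateCount ≤ 200 * (m + 1) * (l.length + 1) ∧ ∀ U, c.toOperator U =
        branch fun β => alternatingSequence U (zSign β * φ₀) (l.map (zSign β * ·)) := by
  induction l with
  | nil =>
    obtain ⟨c, hc, hc', hcU⟩ := gateImplementable_branch_ancillaPhase (Q := Fin m ⊕ Fin n)
      (m := m) (n := n) φ₀
    exact ⟨c, hc, by simpa using hc', hcU⟩
  | cons φ l ih =>
    obtain ⟨c, hc, hc', hcU⟩ := gateImplementable_branch_ancillaPhase (Q := Fin m ⊕ Fin n)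
      (m := m) (n := n) φ
    obtain ⟨d, hd, hd', hdU⟩ := ih
    refine ⟨d ++ ((if Even l.length then .query (succEmbedding m n) else
      .queryInv (succEmbedding m n)) :: c), ?_, ?_, fun U => ?_⟩
    · rw [QueryCircuit.queryCount_append, hd]
      split_ifs <;> simp [QueryCircuit.queryCount, hc]
    · rw [QueryCircuit.gateCount_append, List.length_cons]
      split_ifs <;> simp only [QueryCircuit.gateCount] <;> nlinarith
    · rw [QueryCircuit.toOperator_append, hdU, QueryCircuit.toOperator, hcU]
      have : (if Even l.length then CircuitStep.query (succEmbedding m n) else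
          CircuitStep.queryInv (succEmbedding m n)).toOperator U =
          branch fun _ => if Even l.length then U else Uᴴ := by
        split_ifs <;> rfl
      rw [this, branch_mul, branch_mul]
      simp [alternatingSequence]

/-- The circuit that averages the alternating sequences of opposite phases. -/
theorem exists_circuit_average (m n : ℕ) (φ₀ : ℝ) (l : List ℝ) :
    ∃ c : QueryCircuit (Fin m ⊕ Fin n) (Fin (m + 1) ⊕ Fin n), c.queryCount = l.length ∧
      c.gateCount ≤ 200 * (m + 1) * (l.length + 1) + 2 ∧ ∀ U, ancillaBlock (c.toOperator U) =
        (1 / 2 : ℂ) • (ancillaBlock (alternatingSequence U φ₀ l) +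
          ancillaBlock (alternatingSequence U (-φ₀) (l.map (-·)))) := by
  obtain ⟨c, hc, hc', hcU⟩ := exists_circuit_alternatingSequence m n φ₀ l
  obtain ⟨h, hh, hh', hhU⟩ := gateImplementable_hadamardOn (Q := Fin m ⊕ Fin n)
    (Sum.inl 0 : Fin (m + 1) ⊕ Fin n)
  -- The Hadamard gates prepare and project on `|+⟩`, where a block-diagonal operator has the mean
  -- of its blocks as matrix element.
  refine ⟨h ++ (c ++ h), ?_, ?_, fun U => ?_⟩
  · simp only [QueryCircuit.queryCount_append]
    omega
  · simp only [QueryCircuit.gateCount_append]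
    omega
  · rw [QueryCircuit.toOperator_append, QueryCircuit.toOperator_append, hcU, hhU]
    ext x y
    rw [ancillaBlock, hadamardOn_conj_apply]
    have key : ∀ (M : Fin 2 → QOperator (Fin m ⊕ Fin n)) (b b' : Fin 2),
        branch M (Function.update (Sum.elim (fun _ => 0) x) (Sum.inl 0) b)
          (Function.update (Sum.elim (fun _ => 0) y) (Sum.inl 0) b') =
        if b = b' then ancillaBlock (M b) x y else 0 := by
      intro M b b'
      have hcomp : ∀ (x : Fin n → Fin 2) (b : Fin 2),
          Function.update (Sum.elim (fun _ => 0) x : Fin (m + 1) ⊕ Fin n → Fin 2) (Sum.inl 0) b ∘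
            succEmbedding m n = Sum.elim (fun _ => 0) x := by
        intro x b
        funext i
        rcases i with i | i
        · rw [Function.comp_apply, succEmbedding_inl, Function.update_of_ne (by simp)]
          rfl
        · rw [Function.comp_apply, succEmbedding_inr, Function.update_of_ne (by simp)]
          rfl
      have hag : AgreeOff (succEmbedding m n)
          (Function.update (Sum.elim (fun _ => 0) x : Fin (m + 1) ⊕ Fin n → Fin 2) (Sum.inl 0) b)
          (Function.update (Sum.elim (fun _ => 0) y) (Sum.inl 0) b') ↔ b = b' := by
        constructor
        · intro h
          simpa using h _ notMem_range_succEmbedding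
        · rintro rfl w hw
          rcases w with w | w
          · by_cases hw0 : w = 0
            · subst hw0; simp
            · simp [hw0]
          · exact absurd ⟨Sum.inr w, rfl⟩ hw
      rw [branch, applyFamily, hcomp, hcomp]
      simp only [hag, Function.update_self]
      rfl
    simp only [key, Fin.sum_univ_two, Sum.elim_inl]
    simp [bitSign, zSign, ancillaBlock]

end Alternating

/-! ### The isometry that adjoins zero ancillas -/

section Isometry

variable {m n : ℕ}

/-- The isometry `|0^m⟩ ⊗ I_n`. -/
noncomputable def zeroIsometry (m n : ℕ) : Matrix (Fin m ⊕ Fin n → Fin 2) (Fin n → Fin 2) ℂ :=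
  fun x y => if x = Sum.elim (fun _ => 0) y then 1 else 0

theorem ancillaBlock_eq (M : QOperator (Fin m ⊕ Fin n)) :
    ancillaBlock M = (zeroIsometry m n)ᴴ * M * zeroIsometry m n := by
  ext x y
  simp [zeroIsometry, ancillaBlock, Matrix.mul_apply]

theorem zeroIsometry_conjTranspose_mul_self :
    (zeroIsometry m n)ᴴ * zeroIsometry m n = 1 := by
  ext x y
  have h : (Sum.elim (fun _ => 0) y : Fin m ⊕ Fin n → Fin 2) = Sum.elim (fun _ => 0) x ↔ x = y :=
    ⟨fun h => funext fun i => (congrFun h (Sum.inr i)).symm, fun h => by rw [h]⟩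
  simp [zeroIsometry, Matrix.mul_apply, Matrix.one_apply, h]

theorem eq_elim_iff (x : Fin m ⊕ Fin n → Fin 2) (y : Fin n → Fin 2) :
    x = Sum.elim (fun _ => 0) y ↔ (∀ i, x (Sum.inl i) = 0) ∧ x ∘ Sum.inr = y := by
  constructor
  · rintro rfl
    exact ⟨fun _ => rfl, rfl⟩
  · rintro ⟨h, rfl⟩
    funext i
    rcases i with i | i
    · exact h i
    · rfl

theorem ancillaPhase_mul_zeroIsometry (φ : ℝ) :
    ancillaPhase m n φ * zeroIsometry m n = Complex.exp (φ * Complex.I) • zeroIsometry m n := by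
  ext x y
  simp only [ancillaPhase, phaseDiagonal, Matrix.diagonal_mul, zeroIsometry, Matrix.smul_apply,
    smul_eq_mul]
  by_cases h : x = Sum.elim (fun _ => 0) y
  · have := ((eq_elim_iff x y).1 h).1
    simp [h]
  · simp [h]

theorem ancillaPhase_eq (φ : ℝ) :
    ancillaPhase m n φ = Complex.exp (φ * Complex.I) • (zeroIsometry m n * (zeroIsometry m n)ᴴ) +
      Complex.exp (-φ * Complex.I) • (1 - zeroIsometry m n * (zeroIsometry m n)ᴴ) := by
  have hproj : zeroIsometry m n * (zeroIsometry m n)ᴴ =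
      Matrix.diagonal fun x => if ∀ i : Fin m, x (Sum.inl i) = 0 then 1 else 0 := by
    ext x y
    by_cases hxy : x = y
    · subst hxy
      simp only [zeroIsometry, Matrix.mul_apply, Matrix.conjTranspose_apply, eq_elim_iff,
        Matrix.diagonal_apply_eq]
      by_cases h : ∀ i : Fin m, x (Sum.inl i) = 0 <;> simp [h]
    · rw [Matrix.diagonal_apply_ne _ hxy, Matrix.mul_apply]
      refine Finset.sum_eq_zero fun z _ => ?_
      by_cases hx : x = Sum.elim (fun _ => 0) z
      · have hy : y ≠ Sum.elim (fun _ => 0) z := fun hy => hxy (hx.trans hy.symm)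
        simp [zeroIsometry, hy]
      · simp [zeroIsometry, hx]
  rw [hproj]
  ext x y
  by_cases hxy : x = y
  · subst hxy
    by_cases h : ∀ i : Fin m, x (Sum.inl i) = 0 <;> simp [ancillaPhase, phaseDiagonal, h]
  · simp [ancillaPhase, phaseDiagonal, hxy]

/-- The block is a compression of a unitary by an isometry, and an `E` with `Eᴴ E = 1` has norm at
most one. -/
theorem norm_ancillaBlock_le {U : QOperator (Fin m ⊕ Fin n)}
    (hU : U ∈ Matrix.unitaryGroup (Fin m ⊕ Fin n → Fin 2) ℂ) : ‖ancillaBlock U‖ ≤ 1 := by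
  have key : ∀ {ι κ : Type} [Fintype ι] [Fintype κ] [DecidableEq ι] [DecidableEq κ]
      (E : Matrix ι κ ℂ), Eᴴ * E = 1 → ‖E‖ ≤ 1 := by
    intro ι κ _ _ _ _ E hE
    have h1 := Matrix.l2_opNorm_conjTranspose_mul_self E
    rw [hE] at h1
    have h2 : ‖(1 : Matrix κ κ ℂ)‖ ≤ 1 := by
      rw [← Matrix.diagonal_one, Matrix.l2_opNorm_diagonal]
      exact (pi_norm_le_iff_of_nonneg zero_le_one).2 fun i => by simp
    nlinarith [norm_nonneg E]
  have hE := key _ (zeroIsometry_conjTranspose_mul_self (m := m) (n := n))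
  have hU' := key U (by rw [← Matrix.star_eq_conjTranspose]; exact Matrix.mem_unitaryGroup_iff'.1 hU)
  rw [ancillaBlock_eq]
  refine (Matrix.l2_opNorm_mul _ _).trans (mul_le_one₀ ((Matrix.l2_opNorm_mul _ _).trans
    (mul_le_one₀ ?_ (norm_nonneg _) hU')) (norm_nonneg _) hE)
  rwa [Matrix.l2_opNorm_conjTranspose]

end Isometry

/-! ### Quantum singular value transformation -/

section SingularValueTransformation

open Polynomial

/-- The pair of polynomials produced by an alternating sequence of phases and signal operators, in
the square of the signal. -/
noncomputable def sequencePair (φ₀ : ℝ) : List ℝ → ℂ[X] × ℂ[X]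
  | [] => (C (Complex.exp (φ₀ * Complex.I)), 0)
  | φ :: l =>
    if Even l.length then
      (C (Complex.exp (φ * Complex.I)) *
          ((sequencePair φ₀ l).1 + (1 - X) * (sequencePair φ₀ l).2),
        C (Complex.exp (-φ * Complex.I)) *
          ((sequencePair φ₀ l).1 - X * (sequencePair φ₀ l).2))
    else
      (C (Complex.exp (φ * Complex.I)) *
          (X * (sequencePair φ₀ l).1 + (1 - X) * (sequencePair φ₀ l).2),
        C (Complex.exp (-φ * Complex.I)) *
          ((sequencePair φ₀ l).1 - (sequencePair φ₀ l).2))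

theorem conj_exp_mul_I (φ : ℝ) :
    (starRingEnd ℂ) (Complex.exp (φ * Complex.I)) = Complex.exp (-φ * Complex.I) := by
  rw [← Complex.exp_conj]
  simp

theorem conj_exp_neg_mul_I (φ : ℝ) :
    (starRingEnd ℂ) (Complex.exp (-φ * Complex.I)) = Complex.exp (φ * Complex.I) := by
  rw [← Complex.exp_conj]
  simp

/-- The recursion has real coefficients apart from the phases, so negating these conjugates both
polynomials. -/
theorem sequencePair_neg (φ₀ : ℝ) (l : List ℝ) :
    sequencePair (-φ₀) (l.map (-·)) = ((sequencePair φ₀ l).1.map (starRingEnd ℂ),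
      (sequencePair φ₀ l).2.map (starRingEnd ℂ)) := by
  induction l with
  | nil => simp [sequencePair, conj_exp_mul_I]
  | cons φ l ih =>
    simp only [List.map_cons, sequencePair, List.length_map, ih]
    split_ifs <;> simp [conj_exp_mul_I, conj_exp_neg_mul_I, -neg_mul]

variable {m n : ℕ}

theorem alternatingSequence_mul_zeroIsometry {U : QOperator (Fin m ⊕ Fin n)}
    (hU : U ∈ Matrix.unitaryGroup (Fin m ⊕ Fin n → Fin 2) ℂ) (φ₀ : ℝ) (l : List ℝ) :
    alternatingSequence U φ₀ l * zeroIsometry m n =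
      if Even l.length then
        zeroIsometry m n * aeval ((ancillaBlock U)ᴴ * ancillaBlock U) (sequencePair φ₀ l).1 +
          (1 - zeroIsometry m n * (zeroIsometry m n)ᴴ) * (Uᴴ * (zeroIsometry m n * ancillaBlock U)) *
            aeval ((ancillaBlock U)ᴴ * ancillaBlock U) (sequencePair φ₀ l).2
      else
        zeroIsometry m n * ancillaBlock U *
            aeval ((ancillaBlock U)ᴴ * ancillaBlock U) (sequencePair φ₀ l).1 +
          (1 - zeroIsometry m n * (zeroIsometry m n)ᴴ) * (U * zeroIsometry m n) *
            aeval ((ancillaBlock U)ᴴ * ancillaBlock U) (sequencePair φ₀ l).2 := by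
  have hUU : U * Uᴴ = 1 := Matrix.mem_unitaryGroup_iff.1 hU
  have hUU' : Uᴴ * U = 1 := Matrix.mem_unitaryGroup_iff'.1 hU
  have hA := ancillaBlock_eq U
  have hE := zeroIsometry_conjTranspose_mul_self (m := m) (n := n)
  have hR := ancillaPhase_eq (m := m) (n := n)
  have hRE := ancillaPhase_mul_zeroIsometry (m := m) (n := n)
  set E := zeroIsometry m n
  set A := ancillaBlock U
  set Y := Aᴴ * A with hY
  have hAH : Aᴴ = Eᴴ * Uᴴ * E := by
    rw [hA]
    simp only [Matrix.conjTranspose_mul, Matrix.conjTranspose_conjTranspose, Matrix.mul_assoc]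
  set G := (1 - E * Eᴴ) * (U * E) with hG
  set H := (1 - E * Eᴴ) * (Uᴴ * (E * A)) with hH
  have hG' : G = U * E - E * A := by
    rw [hG, hA, Matrix.sub_mul, Matrix.one_mul]
    simp only [Matrix.mul_assoc]
  have hH' : H = Uᴴ * (E * A) - E * Y := by
    rw [hH, hY, hAH, Matrix.sub_mul, Matrix.one_mul]
    simp only [Matrix.mul_assoc]
  -- `F1` to `F4` show that `U` and `Uᴴ` exchange the column spaces of `E, H` and `E * A, G` with
  -- coefficients polynomial in `Y`. These coefficients are the recursion of `sequencePair`; no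
  -- singular value decomposition is needed.
  have F1 : U * E = E * A + G := by rw [hG']; abel
  have F3 : Uᴴ * (E * A) = E * Y + H := by rw [hH']; abel
  have F2 : U * H = E * A * (1 - Y) - G * Y := by
    rw [hH', Matrix.mul_sub, ← Matrix.mul_assoc, hUU, Matrix.one_mul, ← Matrix.mul_assoc, F1,
      Matrix.mul_sub, Matrix.add_mul, Matrix.mul_one]
    abel
  have F4 : Uᴴ * G = E * (1 - Y) - H := by
    rw [hG', Matrix.mul_sub, ← Matrix.mul_assoc, hUU', Matrix.one_mul, F3, Matrix.mul_sub,
      Matrix.mul_one]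
    abel
  have hRc : ∀ φ, ancillaPhase m n φ * (1 - E * Eᴴ) =
      Complex.exp (-φ * Complex.I) • (1 - E * Eᴴ) := by
    intro φ
    have h0 : E * Eᴴ * (1 - E * Eᴴ) = 0 := by
      rw [Matrix.mul_sub, Matrix.mul_one, ← Matrix.mul_assoc, Matrix.mul_assoc E Eᴴ E, hE,
        Matrix.mul_one, sub_self]
    rw [hR, Matrix.add_mul, Matrix.smul_mul, Matrix.smul_mul, h0, smul_zero, zero_add,
      Matrix.sub_mul, h0, Matrix.one_mul, sub_zero]
  have hRG : ∀ φ, ancillaPhase m n φ * G = Complex.exp (-φ * Complex.I) • G := by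
    intro φ
    rw [hG, ← Matrix.mul_assoc, hRc, Matrix.smul_mul]
  have hRH : ∀ φ, ancillaPhase m n φ * H = Complex.exp (-φ * Complex.I) • H := by
    intro φ
    rw [hH, ← Matrix.mul_assoc, hRc, Matrix.smul_mul]
  induction l with
  | nil =>
    simp [alternatingSequence, sequencePair, hRE, Algebra.algebraMap_eq_smul_one]
  | cons φ l ih =>
    rw [alternatingSequence, Matrix.mul_assoc, ih, Matrix.mul_assoc]
    by_cases hl : Even l.length
    · have hl' : ¬ Even (φ :: l).length := by
        rw [List.length_cons, Nat.even_add_one, not_not]; exact hl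
      rw [if_pos hl, if_pos hl, if_neg hl']
      simp only [sequencePair, if_pos hl, map_mul, map_add, map_sub, map_one, aeval_X, aeval_C,
        Algebra.algebraMap_eq_smul_one]
      generalize aeval Y (sequencePair φ₀ l).1 = p
      generalize aeval Y (sequencePair φ₀ l).2 = q
      have : U * (E * p + H * q) = E * A * (p + (1 - Y) * q) + G * (p - Y * q) := by
        rw [Matrix.mul_add, ← Matrix.mul_assoc, ← Matrix.mul_assoc, F1, F2]
        simp only [Matrix.add_mul, Matrix.sub_mul, Matrix.mul_add, Matrix.mul_sub,
          Matrix.mul_assoc]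
        abel
      rw [this, Matrix.mul_add, ← Matrix.mul_assoc, ← Matrix.mul_assoc, ← Matrix.mul_assoc,
        hRE, hRG]
      simp only [Matrix.smul_mul, Matrix.mul_smul, Matrix.one_mul]
    · have hl' : Even (φ :: l).length := by
        rw [List.length_cons, Nat.even_add_one]; exact hl
      rw [if_neg hl, if_neg hl, if_pos hl']
      simp only [sequencePair, if_neg hl, map_mul, map_add, map_sub, map_one, aeval_X, aeval_C,
        Algebra.algebraMap_eq_smul_one]
      generalize aeval Y (sequencePair φ₀ l).1 = p
      generalize aeval Y (sequencePair φ₀ l).2 = q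
      have : Uᴴ * (E * A * p + G * q) = E * (Y * p + (1 - Y) * q) + H * (p - q) := by
        rw [Matrix.mul_add, ← Matrix.mul_assoc Uᴴ (E * A) p, ← Matrix.mul_assoc Uᴴ G q, F3, F4]
        simp only [Matrix.add_mul, Matrix.sub_mul, Matrix.mul_add, Matrix.mul_sub,
          Matrix.mul_assoc]
        abel
      rw [this, Matrix.mul_add, ← Matrix.mul_assoc, ← Matrix.mul_assoc, hRE, hRH]
      simp only [Matrix.smul_mul, Matrix.mul_smul, Matrix.one_mul]

theorem ancillaBlock_alternatingSequence {U : QOperator (Fin m ⊕ Fin n)}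
    (hU : U ∈ Matrix.unitaryGroup (Fin m ⊕ Fin n → Fin 2) ℂ) (φ₀ : ℝ) {l : List ℝ}
    (hl : Odd l.length) : ancillaBlock (alternatingSequence U φ₀ l) =
      ancillaBlock U * aeval ((ancillaBlock U)ᴴ * ancillaBlock U) (sequencePair φ₀ l).1 := by
  have hE := zeroIsometry_conjTranspose_mul_self (m := m) (n := n)
  have h0 : (zeroIsometry m n)ᴴ * (1 - zeroIsometry m n * (zeroIsometry m n)ᴴ) = 0 := by
    rw [Matrix.mul_sub, Matrix.mul_one, ← Matrix.mul_assoc, hE, Matrix.one_mul, sub_self]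
  rw [ancillaBlock_eq, Matrix.mul_assoc, alternatingSequence_mul_zeroIsometry hU,
    if_neg (Nat.not_even_iff_odd.2 hl), Matrix.mul_add, Matrix.mul_assoc (1 - _),
    ← Matrix.mul_assoc _ (1 - _), h0, Matrix.zero_mul, add_zero, ← Matrix.mul_assoc,
    ← Matrix.mul_assoc, hE, Matrix.one_mul]

end SingularValueTransformation

/-! ### Nonnegative polynomials on the unit interval -/

section MarkovLukacs

open Polynomial

/-- `f = B² + X (1 - X) C²` with `deg f ≤ 2 h` termwise. -/
def IsEvenLukacs (h : ℕ) (f : ℝ[X]) : Prop :=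
  ∃ B C : ℝ[X], B.natDegree ≤ h ∧ (X * C).natDegree ≤ h ∧ f = B ^ 2 + X * (1 - X) * C ^ 2

/-- `f = X B² + (1 - X) C²` with `deg f ≤ 2 h + 1` termwise. -/
def IsOddLukacs (h : ℕ) (f : ℝ[X]) : Prop :=
  ∃ B C : ℝ[X], B.natDegree ≤ h ∧ C.natDegree ≤ h ∧ f = X * B ^ 2 + (1 - X) * C ^ 2

theorem natDegree_le_of_X_mul {f : ℝ[X]} {h : ℕ} (hf : (X * f).natDegree ≤ h) :
    f.natDegree ≤ h := by
  by_cases h0 : f = 0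
  · simp [h0]
  · rw [natDegree_X_mul h0] at hf
    omega

theorem natDegree_one_sub_X_mul_le {f : ℝ[X]} {h : ℕ} (hf : (X * f).natDegree ≤ h) :
    ((1 - X) * f).natDegree ≤ h := by
  rw [sub_mul, one_mul]
  exact (natDegree_sub_le_of_le (natDegree_le_of_X_mul hf) hf).trans (max_self h).le

theorem natDegree_X_mul_le_succ {f : ℝ[X]} {h : ℕ} (hf : f.natDegree ≤ h) :
    (X * f).natDegree ≤ h + 1 :=
  (natDegree_mul_le_of_le natDegree_X_le hf).trans (by omega)

/-- Norm form identity `(B² + t C²)(D² + t E²) = (B D - t C E)² + t (B E + C D)²` with `t = X (1 -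
X)`. Bounding the degree of `X * C` rather than of `C` forces `C = 0` when `h = 0`. -/
theorem IsEvenLukacs.mul {h k : ℕ} {f g : ℝ[X]} (hf : IsEvenLukacs h f) (hg : IsEvenLukacs k g) :
    IsEvenLukacs (h + k) (f * g) := by
  obtain ⟨B, C, hB, hC, rfl⟩ := hf
  obtain ⟨D, E, hD, hE, rfl⟩ := hg
  refine ⟨B * D - X * C * ((1 - X) * E), B * E + C * D, ?_, ?_, by ring⟩
  · exact (natDegree_sub_le_of_le (natDegree_mul_le_of_le hB hD)
      (natDegree_mul_le_of_le hC (natDegree_one_sub_X_mul_le hE))).trans (max_self _).le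
  · rw [show X * (B * E + C * D) = B * (X * E) + X * C * D by ring]
    exact natDegree_add_le_of_degree_le (natDegree_mul_le_of_le hB hE)
      (natDegree_mul_le_of_le hC hD)

theorem IsEvenLukacs.mul_odd {h k : ℕ} {f g : ℝ[X]} (hf : IsEvenLukacs h f)
    (hg : IsOddLukacs k g) : IsOddLukacs (h + k) (f * g) := by
  obtain ⟨B, C, hB, hC, rfl⟩ := hf
  obtain ⟨D, E, hD, hE, rfl⟩ := hg
  refine ⟨B * D + (1 - X) * C * E, B * E - X * C * D, ?_, ?_, by ring⟩
  · exact natDegree_add_le_of_degree_le (natDegree_mul_le_of_le hB hD)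
      (natDegree_mul_le_of_le (natDegree_one_sub_X_mul_le hC) hE)
  · exact (natDegree_sub_le_of_le (natDegree_mul_le_of_le hB hE)
      (natDegree_mul_le_of_le hC hD)).trans (max_self _).le

theorem IsOddLukacs.mul {h k : ℕ} {f g : ℝ[X]} (hf : IsOddLukacs h f) (hg : IsOddLukacs k g) :
    IsEvenLukacs (h + k + 1) (f * g) := by
  obtain ⟨B, C, hB, hC, rfl⟩ := hf
  obtain ⟨D, E, hD, hE, rfl⟩ := hg
  refine ⟨X * (B * D) + (1 - X) * (C * E), B * E - C * D, ?_, ?_, by ring⟩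
  · exact natDegree_add_le_of_degree_le (natDegree_X_mul_le_succ (natDegree_mul_le_of_le hB hD))
      (natDegree_one_sub_X_mul_le (natDegree_X_mul_le_succ (natDegree_mul_le_of_le hC hE)))
  · exact natDegree_X_mul_le_succ ((natDegree_sub_le_of_le (natDegree_mul_le_of_le hB hE)
      (natDegree_mul_le_of_le hC hD)).trans (max_self _).le)

/-- A representation of `f` as a nonnegative combination of squares on `[0, 1]`. -/
def IsLukacs (e : ℕ) (f : ℝ[X]) : Prop :=
  ∃ h, (e = 2 * h ∧ IsEvenLukacs h f) ∨ (e = 2 * h + 1 ∧ IsOddLukacs h f)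

theorem IsLukacs.mul {d e : ℕ} {f g : ℝ[X]} (hf : IsLukacs d f) (hg : IsLukacs e g) :
    IsLukacs (d + e) (f * g) := by
  obtain ⟨h, ⟨rfl, hf⟩ | ⟨rfl, hf⟩⟩ := hf <;> obtain ⟨k, ⟨rfl, hg⟩ | ⟨rfl, hg⟩⟩ := hg
  · exact ⟨h + k, Or.inl ⟨by ring, hf.mul hg⟩⟩
  · exact ⟨h + k, Or.inr ⟨by ring, hf.mul_odd hg⟩⟩
  · exact ⟨h + k, Or.inr ⟨by ring, by rw [mul_comm, add_comm]; exact hg.mul_odd hf⟩⟩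
  · exact ⟨h + k + 1, Or.inl ⟨by ring, hf.mul hg⟩⟩

theorem isLukacs_C {c : ℝ} (hc : 0 ≤ c) : IsLukacs 0 (C c) :=
  ⟨0, Or.inl ⟨rfl, C √c, 0, by simp, by simp, by
    rw [← C_pow, Real.sq_sqrt hc]; simp⟩⟩

theorem isLukacs_linear {a b : ℝ} (ha : 0 ≤ a) (hb : 0 ≤ b) :
    IsLukacs 1 (C a * X + C b * (1 - X)) :=
  ⟨0, Or.inr ⟨rfl, C √a, C √b, by simp, by simp, by
    rw [← C_pow, ← C_pow, Real.sq_sqrt ha, Real.sq_sqrt hb]; ring⟩⟩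

theorem isLukacs_X_sub_C_sq (r : ℝ) : IsLukacs 2 ((X - C r) ^ 2) :=
  ⟨1, Or.inl ⟨rfl, X - C r, 0, by simp, by simp, by ring⟩⟩

/-- The quadratic is `|x - z|²`, with values `‖z‖²` at `0` and `s²` at `1`. The square of the linear
interpolation from `-‖z‖` to `s` matches both, and the remaining multiple of `x (1 - x)` is
nonnegative by the triangle inequality `1 ≤ ‖z‖ + s`. -/
theorem isLukacs_quadratic (z : ℂ) : IsLukacs 2 (X ^ 2 - C (2 * z.re) * X + C (‖z‖ ^ 2)) := by
  set s := ‖1 - z‖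
  have hs : s ^ 2 = 1 - 2 * z.re + ‖z‖ ^ 2 := by
    rw [Complex.sq_norm, Complex.sq_norm, Complex.normSq_apply, Complex.normSq_apply]
    simp only [Complex.sub_re, Complex.one_re, Complex.sub_im, Complex.one_im]
    ring
  have h1 : 1 ≤ ‖z‖ + s := by
    have := norm_add_le z (1 - z)
    simpa using this
  have h2 : 0 ≤ (‖z‖ + s) ^ 2 - 1 := by nlinarith
  have h3 : 2 * z.re = 2 * ‖z‖ * (‖z‖ + s) - ((‖z‖ + s) ^ 2 - 1) := by linear_combination hs
  refine ⟨1, Or.inl ⟨rfl, C (‖z‖ + s) * X - C ‖z‖, C √((‖z‖ + s) ^ 2 - 1), ?_, ?_, ?_⟩⟩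
  · compute_degree
  · compute_degree
  · have h4 : C √((‖z‖ + s) ^ 2 - 1) ^ 2 = (C (‖z‖ + s) ^ 2 - 1 : ℝ[X]) := by
      rw [← C_pow, Real.sq_sqrt h2]
      simp
    rw [h4, h3]
    simp only [map_add, map_sub, map_mul, map_pow, map_one, map_ofNat]
    ring

theorem eval_nonneg_of_ne {g : ℝ[X]} {r : ℝ}
    (hg : ∀ x ∈ Set.Ioo (0 : ℝ) 1, x ≠ r → 0 ≤ g.eval x) :
    ∀ x ∈ Set.Ioo (0 : ℝ) 1, 0 ≤ g.eval x := by
  intro x hx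
  by_cases hxr : x = r
  · subst hxr
    have hclosed : IsClosed {y : ℝ | 0 ≤ g.eval y} := isClosed_le continuous_const g.continuous
    have hsub : Set.Ioo x 1 ⊆ {y : ℝ | 0 ≤ g.eval y} :=
      fun y hy => hg y ⟨hx.1.trans hy.1, hy.2⟩ hy.1.ne'
    have := closure_minimal hsub hclosed
    rw [closure_Ioo hx.2.ne] at this
    exact this ⟨le_rfl, hx.2.le⟩
  · exact hg x hx hxr

/-- The theorem of Markov and Lukács on the interval `[0, 1]`. -/
theorem isLukacs_of_nonneg (f : ℝ[X]) (hf : ∀ x ∈ Set.Ioo (0 : ℝ) 1, 0 ≤ f.eval x) :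
    IsLukacs f.natDegree f := by
  induction hd : f.natDegree using Nat.strong_induction_on generalizing f with
  | _ d ih =>
  subst hd
  by_cases hd0 : f.natDegree = 0
  · rw [hd0]
    rw [eq_C_of_natDegree_eq_zero hd0] at hf ⊢
    refine isLukacs_C ?_
    simpa using hf (1 / 2) (by norm_num)
  have hf0 : f ≠ 0 := by
    rintro rfl
    simp at hd0
  -- It suffices to split off a nonconstant factor that has a representation itself and leaves a
  -- cofactor nonnegative on the interval.
  have step : ∀ q g : ℝ[X], f = q * g → 0 < q.natDegree → IsLukacs q.natDegree q →
      (∀ x ∈ Set.Ioo (0 : ℝ) 1, 0 ≤ g.eval x) → IsLukacs f.natDegree f := by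
    intro q g hfq hq hqL hg
    have hq0 : q ≠ 0 := by
      rintro rfl
      simp at hq
    have hg0 : g ≠ 0 := by
      rintro rfl
      exact hf0 (by simpa using hfq)
    have hdeg : f.natDegree = q.natDegree + g.natDegree := by
      rw [hfq, natDegree_mul hq0 hg0]
    have := hqL.mul (ih g.natDegree (by omega) g hg rfl)
    rw [hdeg, hfq]
    exact this
  obtain ⟨z, hz⟩ := IsAlgClosed.exists_aeval_eq_zero ℂ f (by
    rw [degree_eq_natDegree hf0]
    exact_mod_cast hd0)
  by_cases him : z.im = 0
  · have hz' : z = ((z.re : ℝ) : ℂ) := Complex.ext rfl (by simpa using him)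
    set r := z.re
    have hroot : f.IsRoot r := by
      rw [hz', ← Complex.coe_algebraMap, aeval_algebraMap_apply] at hz
      simpa using hz
    -- A root outside `(0, 1)` yields, up to sign, a linear factor that is a nonnegative combination
    -- of `X` and `1 - X`.
    rcases le_or_gt r 0 with hr | hr
    · obtain ⟨g, hg⟩ := dvd_iff_isRoot.2 hroot
      refine step (X - C r) g hg (by simp) ?_ ?_
      · rw [natDegree_X_sub_C]
        convert isLukacs_linear (a := 1 - r) (b := -r) (by linarith) (by linarith) using 1
        simp only [map_sub, map_neg, map_one]
        ring
      · intro x hx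
        have := hf x hx
        rw [hg, eval_mul] at this
        refine nonneg_of_mul_nonneg_right this ?_
        simp only [eval_sub, eval_X, eval_C]
        linarith [hx.1]
    rcases le_or_gt 1 r with hr1 | hr1
    · obtain ⟨g, hg⟩ := dvd_iff_isRoot.2 hroot
      have hdeg : (C r - X).natDegree = 1 := by
        rw [← neg_sub, natDegree_neg, natDegree_X_sub_C]
      refine step (C r - X) (-g) (by rw [hg]; ring) (by omega) ?_ ?_
      · rw [hdeg]
        convert isLukacs_linear (a := r - 1) (b := r) (by linarith) (by linarith) using 1
        simp only [map_sub, map_one]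
        ring
      · intro x hx
        have := hf x hx
        rw [hg, eval_mul, ← neg_mul_neg, ← eval_neg, ← eval_neg] at this
        refine nonneg_of_mul_nonneg_right this ?_
        simp only [eval_neg, eval_sub, eval_X, eval_C]
        linarith [hx.2]
    -- An interior root is a minimum, hence a multiple root, and a square splits off.
    · have hmin : IsLocalMin (fun x => f.eval x) r := by
        filter_upwards [Ioo_mem_nhds hr hr1] with x hx
        rw [hroot]
        exact hf x hx
      have hder : (derivative f).IsRoot r := by
        have := hmin.deriv_eq_zero
        rwa [Polynomial.deriv] at this
      have hmult := (one_lt_rootMultiplicity_iff_isRoot hf0).2 ⟨hroot, hder⟩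
      obtain ⟨g, hg⟩ := (le_rootMultiplicity_iff hf0).1 hmult
      have hdeg : ((X - C r) ^ 2).natDegree = 2 := by
        rw [natDegree_pow, natDegree_X_sub_C]
      refine step ((X - C r) ^ 2) g hg (by omega) ?_ ?_
      · rw [hdeg]
        exact isLukacs_X_sub_C_sq r
      · refine eval_nonneg_of_ne (r := r) fun x hx hxr => ?_
        have := hf x hx
        rw [hg, eval_mul] at this
        refine nonneg_of_mul_nonneg_right this ?_
        simp only [eval_pow, eval_sub, eval_X, eval_C]
        exact lt_of_le_of_ne (sq_nonneg _) (pow_ne_zero 2 (sub_ne_zero.2 hxr)).symm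
  · obtain ⟨g, hg⟩ := quadratic_dvd_of_aeval_eq_zero_im_ne_zero f hz him
    have hdeg : (X ^ 2 - C (2 * z.re) * X + C (‖z‖ ^ 2) : ℝ[X]).natDegree = 2 := by
      compute_degree!
    refine step _ g hg (by omega) ?_ ?_
    · rw [hdeg]
      exact isLukacs_quadratic z
    · intro x hx
      have := hf x hx
      rw [hg, eval_mul] at this
      refine nonneg_of_mul_nonneg_right this ?_
      have him' : 0 < z.im ^ 2 := by positivity
      have hn : ‖z‖ ^ 2 = z.re ^ 2 + z.im ^ 2 := by
        rw [Complex.sq_norm, Complex.normSq_apply]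
        ring
      simp only [eval_add, eval_sub, eval_mul, eval_pow, eval_X, eval_C, hn]
      nlinarith [sq_nonneg (x - z.re)]

end MarkovLukacs

/-! ### Existence of phase factors -/

section PhaseFactors

open Polynomial

theorem exists_phase_eq {z w : ℂ} (h : z * (starRingEnd ℂ) z = w * (starRingEnd ℂ) w) :
    ∃ φ : ℝ, Complex.exp (-φ * Complex.I) * z = Complex.exp (φ * Complex.I) * w := by
  have hn : ‖z‖ = ‖w‖ := by
    rw [Complex.mul_conj, Complex.mul_conj, Complex.normSq_eq_norm_sq, Complex.normSq_eq_norm_sq]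
      at h
    exact (sq_eq_sq₀ (norm_nonneg _) (norm_nonneg _)).1 (by exact_mod_cast h)
  refine ⟨(z.arg - w.arg) / 2, ?_⟩
  have hz : ‖w‖ * Complex.exp (z.arg * Complex.I) = z := by
    rw [← hn, Complex.norm_mul_exp_arg_mul_I]
  have hw := Complex.norm_mul_exp_arg_mul_I w
  calc Complex.exp (-((z.arg - w.arg) / 2 : ℝ) * Complex.I) * z
      = Complex.exp (-((z.arg - w.arg) / 2 : ℝ) * Complex.I) *
          (‖w‖ * Complex.exp (z.arg * Complex.I)) := by rw [hz]
    _ = Complex.exp (((z.arg - w.arg) / 2 : ℝ) * Complex.I) *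
          (‖w‖ * Complex.exp (w.arg * Complex.I)) := by
        rw [mul_left_comm, ← Complex.exp_add, mul_left_comm (Complex.exp _), ← Complex.exp_add]
        congr 2
        push_cast
        ring
    _ = Complex.exp (((z.arg - w.arg) / 2 : ℝ) * Complex.I) * w := by rw [hw]

theorem exp_mul_exp_neg (φ : ℝ) :
    Complex.exp (φ * Complex.I) * Complex.exp (-φ * Complex.I) = 1 := by
  rw [← Complex.exp_add]
  simp

theorem C_exp_mul_C_exp_neg (φ : ℝ) :
    (C (Complex.exp (φ * Complex.I)) * C (Complex.exp (-φ * Complex.I)) : ℂ[X]) = 1 := by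
  rw [← C_mul, exp_mul_exp_neg, C_1]

theorem natDegree_le_of_coeff_eq_zero {f : ℂ[X]} {h : ℕ} (hf : f.natDegree ≤ h + 1)
    (h0 : f.coeff (h + 1) = 0) : f.natDegree ≤ h := by
  rw [natDegree_le_iff_coeff_eq_zero] at hf ⊢
  intro N hN
  rcases Nat.lt_or_ge (h + 1) N with hN' | hN'
  · exact hf N hN'
  · rwa [show N = h + 1 by omega]

theorem coeff_mul_map_conj {p : ℂ[X]} {h : ℕ} (hp : p.natDegree ≤ h) :
    (p * p.map (starRingEnd ℂ)).coeff (h + h) = p.coeff h * (starRingEnd ℂ) (p.coeff h) := by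
  rw [coeff_mul_add_eq_of_natDegree_le hp (natDegree_map_le.trans hp), coeff_map]

theorem coeff_mul_map_conj_eq_zero {p : ℂ[X]} {h N : ℕ} (hp : p.natDegree ≤ h) (hN : h + h < N) :
    (p * p.map (starRingEnd ℂ)).coeff N = 0 :=
  coeff_eq_zero_of_natDegree_lt
    ((natDegree_mul_le_of_le hp (natDegree_map_le.trans hp)).trans_lt hN)

theorem exists_sequencePair_zero {p q : ℂ[X]} (hp : p.natDegree ≤ 0) (hq : (X * q).natDegree ≤ 0)
    (hpq : p * p.map (starRingEnd ℂ) + X * (1 - X) * (q * q.map (starRingEnd ℂ)) = 1) :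
    ∃ φ₀, sequencePair φ₀ [] = (p, q) := by
  have hq0 : q = 0 := by
    by_contra h
    rw [natDegree_X_mul h] at hq
    omega
  obtain ⟨c, rfl⟩ : ∃ c, p = C c := ⟨_, eq_C_of_natDegree_eq_zero (by omega)⟩
  have hc : ‖c‖ = 1 := by
    rw [hq0, map_C, zero_mul, mul_zero, add_zero, ← C_mul, ← C_1, C_inj, Complex.mul_conj,
      Complex.normSq_eq_norm_sq] at hpq
    have : ‖c‖ ^ 2 = 1 := by exact_mod_cast hpq
    nlinarith [norm_nonneg c]
  refine ⟨c.arg, ?_⟩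
  have := Complex.norm_mul_exp_arg_mul_I c
  rw [hc, Complex.ofReal_one, one_mul] at this
  rw [sequencePair, this, hq0]

theorem phase_mul_map_conj (φ : ℝ) (p : ℂ[X]) :
    C (Complex.exp (φ * Complex.I)) * p * (C (Complex.exp (φ * Complex.I)) * p).map
      (starRingEnd ℂ) = p * p.map (starRingEnd ℂ) := by
  rw [Polynomial.map_mul, map_C, conj_exp_mul_I]
  linear_combination (p * p.map (starRingEnd ℂ)) * C_exp_mul_C_exp_neg φ

theorem phase_neg_mul_map_conj (φ : ℝ) (p : ℂ[X]) :
    C (Complex.exp (-φ * Complex.I)) * p * (C (Complex.exp (-φ * Complex.I)) * p).map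
      (starRingEnd ℂ) = p * p.map (starRingEnd ℂ) := by
  rw [Polynomial.map_mul, map_C, conj_exp_neg_mul_I]
  linear_combination (p * p.map (starRingEnd ℂ)) * C_exp_mul_C_exp_neg φ

/-- Quantum signal processing: every normalized pair of polynomials is produced by some phases. -/
theorem exists_sequencePair (h : ℕ) :
    (∀ p q : ℂ[X], p.natDegree ≤ h → (X * q).natDegree ≤ h →
      p * p.map (starRingEnd ℂ) + X * (1 - X) * (q * q.map (starRingEnd ℂ)) = 1 →
      ∃ φ₀ l, l.length = 2 * h ∧ sequencePair φ₀ l = (p, q)) ∧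
    (∀ p q : ℂ[X], p.natDegree ≤ h → q.natDegree ≤ h →
      X * (p * p.map (starRingEnd ℂ)) + (1 - X) * (q * q.map (starRingEnd ℂ)) = 1 →
      ∃ φ₀ l, l.length = 2 * h + 1 ∧ sequencePair φ₀ l = (p, q)) := by
  have odd_of_even : ∀ h : ℕ,
      (∀ p q : ℂ[X], p.natDegree ≤ h → (X * q).natDegree ≤ h →
        p * p.map (starRingEnd ℂ) + X * (1 - X) * (q * q.map (starRingEnd ℂ)) = 1 →
        ∃ φ₀ l, l.length = 2 * h ∧ sequencePair φ₀ l = (p, q)) →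
      (∀ p q : ℂ[X], p.natDegree ≤ h → q.natDegree ≤ h →
        X * (p * p.map (starRingEnd ℂ)) + (1 - X) * (q * q.map (starRingEnd ℂ)) = 1 →
        ∃ φ₀ l, l.length = 2 * h + 1 ∧ sequencePair φ₀ l = (p, q)) := by
    intro h heven p q hp hq hpq
    -- The coefficient of degree `2 h + 1` of the normalization: the leading coefficients have equal
    -- modulus, so a phase aligns them.
    have htop : p.coeff h * (starRingEnd ℂ) (p.coeff h) =
        q.coeff h * (starRingEnd ℂ) (q.coeff h) := by
      have := congrArg (fun f => coeff f (h + h + 1)) hpq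
      simp only [coeff_add, sub_mul, one_mul, coeff_sub, coeff_X_mul, coeff_mul_map_conj hp,
        coeff_mul_map_conj hq, coeff_mul_map_conj_eq_zero hq (Nat.lt_succ_self _),
        coeff_one, Nat.succ_ne_zero, if_false] at this
      linear_combination this
    obtain ⟨φ, hφ⟩ := exists_phase_eq htop
    have ha := phase_neg_mul_map_conj φ p
    have hb := phase_mul_map_conj φ q
    have ha' : C (Complex.exp (φ * Complex.I)) * (C (Complex.exp (-φ * Complex.I)) * p) = p := by
      linear_combination p * C_exp_mul_C_exp_neg φ
    have hb' : C (Complex.exp (-φ * Complex.I)) * (C (Complex.exp (φ * Complex.I)) * q) = q := by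
      linear_combination q * C_exp_mul_C_exp_neg φ
    have hda : (C (Complex.exp (-φ * Complex.I)) * p).natDegree ≤ h :=
      (natDegree_C_mul_le _ _).trans hp
    have hdb : (C (Complex.exp (φ * Complex.I)) * q).natDegree ≤ h :=
      (natDegree_C_mul_le _ _).trans hq
    have hab : (C (Complex.exp (-φ * Complex.I)) * p).coeff h =
        (C (Complex.exp (φ * Complex.I)) * q).coeff h := by
      rw [coeff_C_mul, coeff_C_mul, hφ]
    generalize C (Complex.exp (-φ * Complex.I)) * p = a at *
    generalize C (Complex.exp (φ * Complex.I)) * q = b at *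
    have hsub : (a - b).natDegree ≤ h :=
      (natDegree_sub_le_of_le hda hdb).trans (max_self _).le
    have hX : (X * (a - b)).natDegree ≤ h := by
      refine natDegree_le_of_coeff_eq_zero
        ((natDegree_mul_le_of_le natDegree_X_le hsub).trans (by omega)) ?_
      rw [coeff_X_mul, coeff_sub, hab, sub_self]
    -- This pair solves `a = P + (1 - X) Q`, `b = P - X Q`. Alignment of the top coefficients
    -- cancels the leading term of `X * (a - b)`, which gives the degree bound.
    obtain ⟨φ₀, l, hl, hpair⟩ := heven (b + X * (a - b)) (a - b)
      (natDegree_add_le_of_degree_le hdb hX) hX (by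
        simp only [Polynomial.map_add, Polynomial.map_mul, Polynomial.map_sub, map_X]
        linear_combination hpq + X * ha + (1 - X) * hb)
    refine ⟨φ₀, φ :: l, by rw [List.length_cons, hl], ?_⟩
    rw [sequencePair, if_pos (by rw [hl]; exact even_two_mul h), hpair]
    refine Prod.ext ?_ ?_
    · linear_combination ha'
    · linear_combination hb'
  have even_of_odd : ∀ h : ℕ,
      (∀ p q : ℂ[X], p.natDegree ≤ h → q.natDegree ≤ h →
        X * (p * p.map (starRingEnd ℂ)) + (1 - X) * (q * q.map (starRingEnd ℂ)) = 1 →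
        ∃ φ₀ l, l.length = 2 * h + 1 ∧ sequencePair φ₀ l = (p, q)) →
      (∀ p q : ℂ[X], p.natDegree ≤ h + 1 → (X * q).natDegree ≤ h + 1 →
        p * p.map (starRingEnd ℂ) + X * (1 - X) * (q * q.map (starRingEnd ℂ)) = 1 →
        ∃ φ₀ l, l.length = 2 * (h + 1) ∧ sequencePair φ₀ l = (p, q)) := by
    intro h hodd p q hp hXq hpq
    have hq : q.natDegree ≤ h := by
      by_cases hq0 : q = 0
      · simp [hq0]
      · rw [natDegree_X_mul hq0] at hXq
        omega
    have htop : p.coeff (h + 1) * (starRingEnd ℂ) (p.coeff (h + 1)) =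
        q.coeff h * (starRingEnd ℂ) (q.coeff h) := by
      have := congrArg (fun f => coeff f (h + h + 1 + 1)) hpq
      have h1 := coeff_mul_map_conj hp
      rw [show h + 1 + (h + 1) = h + h + 1 + 1 by ring] at h1
      simp only [coeff_add, mul_sub, sub_mul, mul_one, coeff_sub, mul_assoc, coeff_X_mul,
        coeff_mul_map_conj hq, coeff_mul_map_conj_eq_zero hq (Nat.lt_succ_self _),
        coeff_one, Nat.succ_ne_zero, if_false, h1] at this
      linear_combination this
    obtain ⟨φ, hφ⟩ := exists_phase_eq htop
    have ha := phase_neg_mul_map_conj φ p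
    have hb := phase_mul_map_conj φ q
    have ha' : C (Complex.exp (φ * Complex.I)) * (C (Complex.exp (-φ * Complex.I)) * p) = p := by
      linear_combination p * C_exp_mul_C_exp_neg φ
    have hb' : C (Complex.exp (-φ * Complex.I)) * (C (Complex.exp (φ * Complex.I)) * q) = q := by
      linear_combination q * C_exp_mul_C_exp_neg φ
    have hda : (C (Complex.exp (-φ * Complex.I)) * p).natDegree ≤ h + 1 :=
      (natDegree_C_mul_le _ _).trans hp
    have hdb : (C (Complex.exp (φ * Complex.I)) * q).natDegree ≤ h :=
      (natDegree_C_mul_le _ _).trans hq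
    have hab : (C (Complex.exp (-φ * Complex.I)) * p).coeff (h + 1) =
        (C (Complex.exp (φ * Complex.I)) * q).coeff h := by
      rw [coeff_C_mul, coeff_C_mul, hφ]
    generalize C (Complex.exp (-φ * Complex.I)) * p = a at *
    generalize C (Complex.exp (φ * Complex.I)) * q = b at *
    have hsub : (a - X * b).natDegree ≤ h := by
      refine natDegree_le_of_coeff_eq_zero ((natDegree_sub_le_of_le hda
        ((natDegree_mul_le_of_le natDegree_X_le hdb).trans (by omega))).trans (max_self _).le) ?_
      rw [coeff_sub, coeff_X_mul, hab, sub_self]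
    -- This pair solves `a = X P + (1 - X) Q`, `b = P - Q`; again the leading term of `a - X * b`
    -- cancels.
    obtain ⟨φ₀, l, hl, hpair⟩ := hodd (a - X * b + b) (a - X * b)
      (natDegree_add_le_of_degree_le hsub hdb) hsub (by
        simp only [Polynomial.map_add, Polynomial.map_mul, Polynomial.map_sub, map_X]
        linear_combination hpq + ha + X * (1 - X) * hb)
    refine ⟨φ₀, φ :: l, by rw [List.length_cons, hl]; ring, ?_⟩
    rw [sequencePair, if_neg (by rw [hl]; exact Nat.not_even_two_mul_add_one h), hpair]
    refine Prod.ext ?_ ?_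
    · linear_combination ha'
    · linear_combination hb'
  have heven : ∀ p q : ℂ[X], p.natDegree ≤ h → (X * q).natDegree ≤ h →
      p * p.map (starRingEnd ℂ) + X * (1 - X) * (q * q.map (starRingEnd ℂ)) = 1 →
      ∃ φ₀ l, l.length = 2 * h ∧ sequencePair φ₀ l = (p, q) := by
    induction h with
    | zero =>
      intro p q hp hq hpq
      obtain ⟨φ₀, h₀⟩ := exists_sequencePair_zero hp hq hpq
      exact ⟨φ₀, [], rfl, h₀⟩
    | succ h ih => exact even_of_odd h (odd_of_even h ih)
  exact ⟨heven, odd_of_even h heven⟩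

/-- Every real polynomial `r` with `|x r(x²)| ≤ 1` on `[-1, 1]` is the real part of the polynomial
of an alternating sequence. -/
theorem exists_sequencePair_re {r : ℝ[X]} (hr : r ≠ 0)
    (hr1 : ∀ y ∈ Set.Ioo (0 : ℝ) 1, y * r.eval y ^ 2 ≤ 1) :
    ∃ φ₀ l, l.length = 2 * r.natDegree + 1 ∧
      (sequencePair φ₀ l).1 + (sequencePair φ₀ l).1.map (starRingEnd ℂ) =
        2 * r.map (algebraMap ℝ ℂ) := by
  have hXr : (X * r ^ 2).natDegree = 2 * r.natDegree + 1 := by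
    rw [natDegree_X_mul (pow_ne_zero _ hr), natDegree_pow]
  have hdeg : (1 - X * r ^ 2).natDegree = 2 * r.natDegree + 1 := by
    rw [natDegree_sub_eq_right_of_natDegree_lt, hXr]
    rw [hXr, natDegree_one]
    omega
  have hL := isLukacs_of_nonneg (1 - X * r ^ 2) fun y hy => by
    simpa using hr1 y hy
  rw [hdeg] at hL
  obtain ⟨h, ⟨hh, _⟩ | ⟨hh, B, D, hB, hD, hBD⟩⟩ := hL
  -- The degree of `1 - X r²` is odd, which excludes the even representation.
  · omega
  have hh' : h = r.natDegree := by omega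
  subst hh'
  set ι := algebraMap ℝ ℂ
  have hconj : ∀ f : ℝ[X], (f.map ι).map (starRingEnd ℂ) = f.map ι := by
    intro f
    rw [Polynomial.map_map]
    congr 1
    ext x
    simp [ι]
  have hI : (C Complex.I * C Complex.I : ℂ[X]) = -1 := by
    rw [← C_mul, Complex.I_mul_I, C_neg, C_1]
  have hBD' := congrArg (Polynomial.map ι) hBD
  simp only [Polynomial.map_sub, Polynomial.map_one, Polynomial.map_mul, Polynomial.map_X,
    Polynomial.map_pow, Polynomial.map_add] at hBD'
  -- With `p = r + i B` and `q = D`, the normalization reads `X (r² + B²) + (1 - X) D² = 1`.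
  obtain ⟨φ₀, l, hl, hpair⟩ := (exists_sequencePair r.natDegree).2
    (r.map ι + C Complex.I * B.map ι) (D.map ι)
    (natDegree_add_le_of_degree_le natDegree_map_le
      ((natDegree_C_mul_le _ _).trans (natDegree_map_le.trans hB)))
    (natDegree_map_le.trans hD) (by
      simp only [Polynomial.map_add, Polynomial.map_mul, hconj, map_C, Complex.conj_I, C_neg]
      linear_combination -hBD' - X * B.map ι ^ 2 * hI)
  refine ⟨φ₀, l, hl, ?_⟩
  rw [hpair]
  simp only [Polynomial.map_add, Polynomial.map_mul, hconj, map_C, Complex.conj_I, C_neg]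
  ring

end PhaseFactors

/-! ### The filter polynomial -/

section FilterPolynomial

open Polynomial

/-- The normalized Dirichlet kernel `sin ((2 h + 1) θ) / ((2 h + 1) sin θ)` as a polynomial in
`sin² θ`. -/
noncomputable def dirichletPolynomial (h : ℕ) : ℝ[X] :=
  C (1 / (2 * h + 1 : ℝ)) *
    (1 + 2 * ∑ j ∈ Finset.range h, (Chebyshev.T ℝ ((j + 1 : ℕ) : ℤ)).comp (1 - 2 * X))

theorem natDegree_dirichletPolynomial_le (h : ℕ) : (dirichletPolynomial h).natDegree ≤ h := by
  refine (natDegree_C_mul_le _ _).trans (natDegree_add_le_of_degree_le (by simp) ?_)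
  refine (natDegree_mul_le_of_le (m := 0) (n := h) (natDegree_ofNat 2).le
    (natDegree_sum_le_of_forall_le _ _ fun j hj => ?_)).trans (by omega)
  refine natDegree_comp_le.trans ?_
  have h1 : (1 - 2 * X : ℝ[X]).natDegree ≤ 1 := by compute_degree
  have h2 : (Chebyshev.T ℝ ((j + 1 : ℕ) : ℤ)).natDegree ≤ j + 1 := by
    rw [Chebyshev.natDegree_T]
    omega
  have := Nat.mul_le_mul h2 h1
  have := Finset.mem_range.1 hj
  omega

theorem mul_eval_dirichletPolynomial (h : ℕ) (θ : ℝ) :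
    (2 * h + 1) * (dirichletPolynomial h).eval (Real.sin θ ^ 2) =
      1 + 2 * ∑ j ∈ Finset.range h, Real.cos (2 * ((j + 1 : ℕ) * θ)) := by
  have hk : (2 * h + 1 : ℝ) ≠ 0 := by positivity
  have hc : ∀ j : ℕ, ((Chebyshev.T ℝ ((j + 1 : ℕ) : ℤ)).comp (1 - 2 * X)).eval (Real.sin θ ^ 2) =
      Real.cos (2 * ((j + 1 : ℕ) * θ)) := by
    intro j
    have h1 : (1 - 2 * X : ℝ[X]).eval (Real.sin θ ^ 2) = Real.cos (2 * θ) := by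
      rw [Real.cos_two_mul, Real.cos_sq']
      simp
      ring
    rw [eval_comp, h1, Chebyshev.T_real_cos]
    congr 1
    push_cast
    ring
  rw [dirichletPolynomial, eval_mul, eval_C, eval_add, eval_mul, eval_finsetSum,
    Finset.sum_congr rfl fun j _ => hc j]
  rw [eval_one, eval_ofNat, ← mul_assoc, mul_one_div_cancel hk, one_mul]

theorem sin_mul_eval_dirichletPolynomial (h : ℕ) (θ : ℝ) :
    (2 * h + 1) * (dirichletPolynomial h).eval (Real.sin θ ^ 2) * Real.sin θ =
      Real.sin ((2 * h + 1) * θ) := by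
  rw [mul_eval_dirichletPolynomial]
  induction h with
  | zero => simp
  | succ h ih =>
    rw [Finset.sum_range_succ]
    have h1 : Real.sin ((2 * ((h + 1 : ℕ) : ℝ) + 1) * θ) =
        Real.sin (2 * ((h + 1 : ℕ) * θ) + θ) := by ring_nf
    have h2 : Real.sin ((2 * (h : ℝ) + 1) * θ) = Real.sin (2 * ((h + 1 : ℕ) * θ) - θ) := by
      push_cast
      ring_nf
    rw [h2, Real.sin_sub] at ih
    rw [h1, Real.sin_add]
    linear_combination ih

theorem sin_nat_mul_sq_le (j : ℕ) (θ : ℝ) :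
    Real.sin (j * θ) ^ 2 ≤ j ^ 2 * Real.sin θ ^ 2 := by
  have h : |Real.sin (j * θ)| ≤ j * |Real.sin θ| := by
    induction j with
    | zero => simp
    | succ j ih =>
      rw [Nat.cast_succ, add_mul, one_mul, Real.sin_add]
      refine (abs_add_le _ _).trans ?_
      rw [abs_mul, abs_mul, add_mul, one_mul]
      exact add_le_add ((mul_le_of_le_one_right (abs_nonneg _) (Real.abs_cos_le_one _)).trans ih)
        (mul_le_of_le_one_left (abs_nonneg _) (Real.abs_cos_le_one _))
  rw [← sq_abs (Real.sin (j * θ)), ← sq_abs (Real.sin θ), ← mul_pow]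
  exact pow_le_pow_left₀ (abs_nonneg _) h 2

theorem exists_sin_sq_eq {v : ℝ} (h0 : 0 ≤ v) (h1 : v ≤ 1) : ∃ θ, Real.sin θ ^ 2 = v :=
  ⟨Real.arcsin √v, by
    rw [Real.sin_arcsin (by linarith [Real.sqrt_nonneg v]) (Real.sqrt_le_one.2 h1),
      Real.sq_sqrt h0]⟩

theorem eval_dirichletPolynomial_sq_mul_le (h : ℕ) {v : ℝ} (h0 : 0 ≤ v) (h1 : v ≤ 1) :
    (dirichletPolynomial h).eval v ^ 2 * ((2 * h + 1) ^ 2 * v) ≤ 1 := by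
  obtain ⟨θ, rfl⟩ := exists_sin_sq_eq h0 h1
  have := sin_mul_eval_dirichletPolynomial h θ
  calc _ = ((2 * h + 1) * (dirichletPolynomial h).eval (Real.sin θ ^ 2) * Real.sin θ) ^ 2 := by
        ring
    _ ≤ 1 := by rw [this]; exact Real.sin_sq_le_one _

/-- Each cosine equals `1 - 2 sin² (j θ)`, at least `1 - 2 j² sin² θ`; summing the squares gives
`((2 h + 1)² - 1) / 6`. -/
theorem le_eval_dirichletPolynomial (h : ℕ) {v : ℝ} (h0 : 0 ≤ v) (h1 : v ≤ 1) :
    1 - (2 * h + 1) ^ 2 * v / 6 ≤ (dirichletPolynomial h).eval v := by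
  obtain ⟨θ, rfl⟩ := exists_sin_sq_eq h0 h1
  have key : (2 * h + 1) * (1 - ((2 * h + 1) ^ 2 - 1) * Real.sin θ ^ 2 / 6) ≤
      1 + 2 * ∑ j ∈ Finset.range h, Real.cos (2 * ((j + 1 : ℕ) * θ)) := by
    clear h0 h1
    induction h with
    | zero => simp
    | succ h ih =>
      rw [Finset.sum_range_succ, Real.cos_two_mul, Real.cos_sq']
      have := sin_nat_mul_sq_le (h + 1) θ
      push_cast at *
      nlinarith
  rw [← mul_eval_dirichletPolynomial] at key
  have := le_of_mul_le_mul_left key (by positivity)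
  nlinarith [sq_nonneg (Real.sin θ)]

theorem eval_dirichletPolynomial_sq_le_one (h : ℕ) {v : ℝ} (h0 : 0 ≤ v) (h1 : v ≤ 1) :
    (dirichletPolynomial h).eval v ^ 2 ≤ 1 := by
  obtain ⟨θ, rfl⟩ := exists_sin_sq_eq h0 h1
  have h2 := mul_eval_dirichletPolynomial h θ
  have h3 : |∑ j ∈ Finset.range h, Real.cos (2 * ((j + 1 : ℕ) * θ))| ≤ h := by
    refine (Finset.abs_sum_le_sum_abs _ _).trans ?_
    refine (Finset.sum_le_sum fun j _ => Real.abs_cos_le_one _).trans ?_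
    simp
  rw [abs_le] at h3
  rw [sq_le_one_iff_abs_le_one, abs_le]
  constructor <;> nlinarith

theorem eval_zero_dirichletPolynomial (h : ℕ) : (dirichletPolynomial h).eval 0 = 1 := by
  have := mul_eval_dirichletPolynomial h 0
  have hk : (2 * h + 1 : ℝ) ≠ 0 := by positivity
  have h2 : (2 * h + 1 : ℝ) * (dirichletPolynomial h).eval 0 = (2 * h + 1) * 1 := by
    simpa [add_comm] using this
  exact mul_left_cancel₀ hk h2

/-- The probability that at least `2 M` of `3 M` independent trials succeed, as a polynomial in
the success probability of one trial. -/
noncomputable def majorityPolynomial (M : ℕ) : ℝ[X] :=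
  ∑ j ∈ (Finset.range (3 * M + 1)).filter (2 * M ≤ ·), bernsteinPolynomial ℝ (3 * M) j

theorem natDegree_bernsteinPolynomial_le {N j : ℕ} (h : j ≤ N) :
    (bernsteinPolynomial ℝ N j).natDegree ≤ N := by
  rw [bernsteinPolynomial]
  have h1 : ((N.choose j : ℝ[X]) * X ^ j).natDegree ≤ j := by
    compute_degree
  have h2 : ((1 - X : ℝ[X]) ^ (N - j)).natDegree ≤ N - j := by
    refine natDegree_pow_le.trans ?_
    have : (1 - X : ℝ[X]).natDegree ≤ 1 := by compute_degree
    nlinarith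
  exact (natDegree_mul_le_of_le h1 h2).trans (by omega)

theorem natDegree_majorityPolynomial_le (M : ℕ) : (majorityPolynomial M).natDegree ≤ 3 * M := by
  refine natDegree_sum_le_of_forall_le _ _ fun j hj => ?_
  rw [Finset.mem_filter, Finset.mem_range] at hj
  exact natDegree_bernsteinPolynomial_le (by omega)

theorem eval_bernsteinPolynomial_nonneg (N j : ℕ) {s : ℝ} (h0 : 0 ≤ s) (h1 : s ≤ 1) :
    0 ≤ (bernsteinPolynomial ℝ N j).eval s := by
  have : 0 ≤ 1 - s := by linarith
  simp only [bernsteinPolynomial, eval_mul, eval_natCast, eval_pow, eval_sub, eval_one, eval_X]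
  positivity

theorem eval_majorityPolynomial_nonneg (M : ℕ) {s : ℝ} (h0 : 0 ≤ s) (h1 : s ≤ 1) :
    0 ≤ (majorityPolynomial M).eval s := by
  rw [majorityPolynomial, eval_finsetSum]
  exact Finset.sum_nonneg fun j _ => eval_bernsteinPolynomial_nonneg _ _ h0 h1

theorem sum_eval_bernsteinPolynomial (N : ℕ) (s : ℝ) :
    ∑ j ∈ Finset.range (N + 1), (bernsteinPolynomial ℝ N j).eval s = 1 := by
  rw [← eval_finsetSum, bernsteinPolynomial.sum, eval_one]

theorem eval_majorityPolynomial_le_one (M : ℕ) {s : ℝ} (h0 : 0 ≤ s) (h1 : s ≤ 1) :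
    (majorityPolynomial M).eval s ≤ 1 := by
  rw [majorityPolynomial, eval_finsetSum, ← sum_eval_bernsteinPolynomial (3 * M) s]
  exact Finset.sum_le_sum_of_subset_of_nonneg (Finset.filter_subset _ _)
    fun j _ _ => eval_bernsteinPolynomial_nonneg _ _ h0 h1

/-- Markov's inequality for the binomial distribution. -/
theorem eval_majorityPolynomial_le {M : ℕ} (hM : 0 < M) {s : ℝ} (h0 : 0 ≤ s) (h1 : s ≤ 1) :
    (majorityPolynomial M).eval s ≤ 3 / 2 * s := by
  have hmean : ∑ j ∈ Finset.range (3 * M + 1), (j : ℝ) * (bernsteinPolynomial ℝ (3 * M) j).eval s =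
      3 * M * s := by
    have := congrArg (eval s) (bernsteinPolynomial.sum_smul ℝ (3 * M))
    simpa [eval_finsetSum] using this
  have hle : 2 * M * (majorityPolynomial M).eval s ≤ 3 * M * s := by
    rw [majorityPolynomial, eval_finsetSum, Finset.mul_sum, ← hmean]
    refine (Finset.sum_le_sum fun j hj => ?_).trans
      (Finset.sum_le_sum_of_subset_of_nonneg (Finset.filter_subset _ _) fun j _ _ =>
        mul_nonneg (Nat.cast_nonneg j) (eval_bernsteinPolynomial_nonneg _ _ h0 h1))
    refine mul_le_mul_of_nonneg_right ?_ (eval_bernsteinPolynomial_nonneg _ _ h0 h1)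
    exact_mod_cast (Finset.mem_filter.1 hj).2
  have hM' : (0 : ℝ) < M := by exact_mod_cast hM
  nlinarith

/-- A Chernoff bound for the binomial distribution. -/
theorem one_sub_eval_majorityPolynomial_le (M : ℕ) {s : ℝ} (h0 : 3 / 4 ≤ s) (h1 : s ≤ 1) :
    1 - (majorityPolynomial M).eval s ≤ (243 / 256 : ℝ) ^ M := by
  have hs : 0 ≤ s := by linarith
  have hsplit := Finset.sum_filter_add_sum_filter_not (Finset.range (3 * M + 1)) (2 * M ≤ ·)
    fun j => (bernsteinPolynomial ℝ (3 * M) j).eval s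
  rw [sum_eval_bernsteinPolynomial] at hsplit
  -- The generating function at `2/3`. On the tail `j < 2 M` the weight is at least `(4/9)^M`, while
  -- `s ≥ 3/4` bounds the total by `(27/64)^M`; the ratio is `(243/256)^M`.
  have hgen : ∑ j ∈ Finset.range (3 * M + 1),
      (bernsteinPolynomial ℝ (3 * M) j).eval s * (2 / 3 : ℝ) ^ j = (1 - s / 3) ^ (3 * M) := by
    rw [show 1 - s / 3 = s * (2 / 3) + (1 - s) by ring, add_pow]
    refine Finset.sum_congr rfl fun j _ => ?_
    simp only [bernsteinPolynomial, eval_mul, eval_natCast, eval_pow, eval_sub, eval_one, eval_X,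
      mul_pow]
    ring
  have htail : (∑ j ∈ (Finset.range (3 * M + 1)).filter (¬ 2 * M ≤ ·),
      (bernsteinPolynomial ℝ (3 * M) j).eval s) * (2 / 3 : ℝ) ^ (2 * M) ≤
        (1 - s / 3) ^ (3 * M) := by
    rw [← hgen, Finset.sum_mul]
    refine (Finset.sum_le_sum fun j hj => ?_).trans
      (Finset.sum_le_sum_of_subset_of_nonneg (Finset.filter_subset _ _) fun j _ _ =>
        mul_nonneg (eval_bernsteinPolynomial_nonneg _ _ hs h1) (by positivity))
    refine mul_le_mul_of_nonneg_left ?_ (eval_bernsteinPolynomial_nonneg _ _ hs h1)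
    have := (Finset.mem_filter.1 hj).2
    exact pow_le_pow_of_le_one (by norm_num) (by norm_num) (by omega)
  have hpow : (1 - s / 3) ^ (3 * M) ≤ (27 / 64 : ℝ) ^ M := by
    rw [pow_mul]
    refine pow_le_pow_left₀ (pow_nonneg (by linarith) _) ?_ M
    calc (1 - s / 3) ^ 3 ≤ (3 / 4) ^ 3 := pow_le_pow_left₀ (by linarith) (by linarith) 3
      _ = 27 / 64 := by norm_num
  rw [majorityPolynomial, eval_finsetSum]
  have h49 : (2 / 3 : ℝ) ^ (2 * M) = (4 / 9) ^ M := by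
    rw [pow_mul]
    norm_num
  have h243 : (27 / 64 : ℝ) ^ M = (243 / 256) ^ M * (4 / 9) ^ M := by
    rw [← mul_pow]
    norm_num
  rw [h49] at htail
  rw [h243] at hpow
  have := le_of_mul_le_mul_right (htail.trans hpow) (by positivity)
  linarith

/-- An even filter polynomial that suppresses `|x| < a` and passes `a ≤ |x| ≤ 1`, divided by `x²`
and expressed in `y = x²`. -/
theorem exists_filterPolynomial {a : ℝ} (ha : 0 < a) (ha1 : a ≤ 1) {M : ℕ} (hM : 0 < M) :
    ∃ R : ℝ[X], (R.natDegree : ℝ) ≤ 12 * M / a ∧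
      (∀ x, 0 ≤ x → x ≤ 1 → 0 ≤ x ^ 2 * R.eval (x ^ 2)) ∧
      (∀ x, 0 ≤ x → x ≤ 1 → x ^ 2 * R.eval (x ^ 2) ≤ 1) ∧
      (∀ x, 0 < x → x ≤ 1 → x * R.eval (x ^ 2) ≤ 4 / (3 * a)) ∧
      (∀ x, a ≤ x → x ≤ 1 → 1 - x ^ 2 * R.eval (x ^ 2) ≤ (243 / 256 : ℝ) ^ M) := by
  set h := ⌈1 / a⌉₊
  have hh : 1 / a ≤ h := Nat.le_ceil _
  have hh2 : (h : ℝ) ≤ 2 / a := by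
    have h1 := (Nat.ceil_lt_add_one (by positivity : 0 ≤ 1 / a)).le
    have h2 : 1 ≤ 1 / a := by rw [le_div_iff₀ ha]; linarith
    have h3 : 2 / a = 1 / a + 1 / a := by ring
    change (⌈1 / a⌉₊ : ℝ) ≤ _
    linarith
  set k : ℝ := 2 * h + 1 with hk
  have hk0 : 0 < k := by positivity
  have hka : 2 ≤ k * a := by
    have : 1 ≤ h * a := by rwa [div_le_iff₀ ha] at hh
    nlinarith
  -- Since `k c = 2 / a`, the bound `|sin (k θ)| ≤ 1` with `sin θ = c x` gives `|D| ≤ a / (2 x)`,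
  -- which is at most `1/2` for `x ≥ a`.
  set c : ℝ := 2 / (k * a)
  have hc0 : 0 < c := by positivity
  have hc1 : c ≤ 1 := by
    rw [div_le_one (by positivity)]
    exact hka
  have hkc : k * c = 2 / a := by
    simp only [c]
    field_simp
  let s : ℝ[X] := 1 - (dirichletPolynomial h).comp (C (c ^ 2) * X) ^ 2
  have hs : ∀ x, s.eval (x ^ 2) = 1 - (dirichletPolynomial h).eval (c ^ 2 * x ^ 2) ^ 2 := by
    intro x
    simp [s, eval_comp]
  have hv : ∀ x, 0 ≤ x → x ≤ 1 → 0 ≤ c ^ 2 * x ^ 2 ∧ c ^ 2 * x ^ 2 ≤ 1 := by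
    intro x hx0 hx1
    rw [← mul_pow]
    exact ⟨by positivity, pow_le_one₀ (by positivity) (mul_le_one₀ hc1 hx0 hx1)⟩
  have hkv : ∀ x, k ^ 2 * (c ^ 2 * x ^ 2) = (2 * x / a) ^ 2 := by
    intro x
    rw [← mul_assoc, ← mul_pow, hkc]
    ring
  have hs0 : ∀ x, 0 ≤ x → x ≤ 1 → 0 ≤ s.eval (x ^ 2) := by
    intro x hx0 hx1
    rw [hs]
    linarith [eval_dirichletPolynomial_sq_le_one h (hv x hx0 hx1).1 (hv x hx0 hx1).2]
  have hs1 : ∀ x, s.eval (x ^ 2) ≤ 1 := by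
    intro x
    rw [hs]
    linarith [sq_nonneg ((dirichletPolynomial h).eval (c ^ 2 * x ^ 2))]
  have hs00 : s.eval 0 = 0 := by
    simp [s, eval_comp, eval_zero_dirichletPolynomial]
  have hdvd : X ∣ (majorityPolynomial M).comp s := by
    rw [X_dvd_iff, coeff_zero_eq_eval_zero, eval_comp, hs00]
    -- Positivity of `M` matters: for `M = 0` the majority polynomial is `1` and does not vanish at
    -- `0`.
    have h1 := eval_majorityPolynomial_le hM (s := 0) le_rfl zero_le_one
    have h2 := eval_majorityPolynomial_nonneg M (s := 0) le_rfl zero_le_one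
    linarith
  obtain ⟨R, hR⟩ := hdvd
  have hRx : ∀ x, x ^ 2 * R.eval (x ^ 2) = (majorityPolynomial M).eval (s.eval (x ^ 2)) := by
    intro x
    rw [← eval_comp, hR, eval_mul, eval_X]
  refine ⟨R, ?_, ?_, ?_, ?_, ?_⟩
  · have hsdeg : s.natDegree ≤ 2 * h := by
      refine (natDegree_sub_le_of_le (m := 2 * h) (n := 2 * h) (by simp) ?_).trans
        (max_self _).le
      refine natDegree_pow_le.trans (Nat.mul_le_mul_left 2 (natDegree_comp_le.trans ?_))
      have h1 : (C (c ^ 2) * X : ℝ[X]).natDegree ≤ 1 := by compute_degree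
      have := Nat.mul_le_mul (natDegree_dirichletPolynomial_le h) h1
      omega
    have h1 : R.natDegree ≤ 3 * M * (2 * h) := by
      refine natDegree_le_of_X_mul ?_
      rw [← hR]
      exact natDegree_comp_le.trans (Nat.mul_le_mul (natDegree_majorityPolynomial_le M) hsdeg)
    have h2 : (R.natDegree : ℝ) ≤ 3 * M * (2 * h) := by exact_mod_cast h1
    have hM0 : (0 : ℝ) ≤ M := Nat.cast_nonneg M
    calc (R.natDegree : ℝ) ≤ 6 * M * h := by linarith
      _ ≤ 6 * M * (2 / a) := by gcongr
      _ = 12 * M / a := by ring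
  · intro x hx0 hx1
    rw [hRx]
    exact eval_majorityPolynomial_nonneg M (hs0 x hx0 hx1) (hs1 x)
  · intro x hx0 hx1
    rw [hRx]
    exact eval_majorityPolynomial_le_one M (hs0 x hx0 hx1) (hs1 x)
  · intro x hx0 hx1
    have hkey : x * (x * R.eval (x ^ 2)) ≤ x * (4 / (3 * a)) := by
      have hxx : x * (x * R.eval (x ^ 2)) = x ^ 2 * R.eval (x ^ 2) := by ring
      rw [hxx, hRx]
      set u := 2 * x / a with hu
      have hxu : x = u * a / 2 := by
        rw [hu]
        field_simp
      have hrhs : x * (4 / (3 * a)) = 2 / 3 * u := by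
        rw [hu]
        field_simp
        ring
      have hu0 : 0 ≤ u := by positivity
      rw [hrhs]
      -- The claim is that the filter is at most `2 u / 3`. For `u ≥ 3/2` the bound `1` suffices.
      -- Otherwise Markov's inequality and the lower bound on the kernel give `u² / 2 - u⁴ / 24`,
      -- which falls short of `2 u / 3` by exactly `u (u - 2)² (u + 4) / 24`.
      rcases le_or_gt (3 / 2) u with h32 | h32
      · linarith [eval_majorityPolynomial_le_one M (hs0 x hx0.le hx1) (hs1 x)]
      · have h1 := eval_majorityPolynomial_le hM (hs0 x hx0.le hx1) (hs1 x)
        have h2 := le_eval_dirichletPolynomial h (hv x hx0.le hx1).1 (hv x hx0.le hx1).2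
        rw [← hk, hkv, ← hu] at h2
        rw [hs] at h1
        have h3 : 0 ≤ 1 - u ^ 2 / 6 := by nlinarith
        have h4 := pow_le_pow_left₀ h3 h2 2
        rw [hs]
        have h5 : 0 ≤ u * ((u - 2) ^ 2 * (u + 4)) := by positivity
        nlinarith
    exact le_of_mul_le_mul_left hkey hx0
  · intro x hxa hx1
    have hx0 : 0 < x := ha.trans_le hxa
    rw [hRx]
    refine one_sub_eval_majorityPolynomial_le M ?_ (hs1 x)
    have h1 := eval_dirichletPolynomial_sq_mul_le h (hv x hx0.le hx1).1 (hv x hx0.le hx1).2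
    rw [← hk, hkv] at h1
    have h2 : 2 ≤ 2 * x / a := by
      rw [le_div_iff₀ ha]
      linarith
    have h3 : (2 : ℝ) ^ 2 ≤ (2 * x / a) ^ 2 := pow_le_pow_left₀ (by norm_num) h2 2
    have h4 := mul_le_mul_of_nonneg_left h3
      (sq_nonneg ((dirichletPolynomial h).eval (c ^ 2 * x ^ 2)))
    rw [hs]
    linarith

end FilterPolynomial

/-! ### The Moore–Penrose inverse by functional calculus -/

section MoorePenrose

theorem continuousOn_spectrum {n : ℕ} (A : QOperator (Fin n)) (f : ℝ → ℝ) :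
    ContinuousOn f (spectrum ℝ A) :=
  Matrix.finite_real_spectrum.continuousOn f

/-- The convention `0⁻¹ = 0` makes the functional calculus of `x⁻¹` vanish on the kernel of `A`, as
the pseudoinverse must. Continuity is automatic on a finite spectrum. -/
theorem isMoorePenroseInverse_cfc_inv {n : ℕ} {A : QOperator (Fin n)} (hA : IsSelfAdjoint A) :
    IsMoorePenroseInverse A (cfc (fun x : ℝ => x⁻¹) A) := by
  have hid : cfc (fun x : ℝ => x) A = A := cfc_id' ℝ A
  have hc := continuousOn_spectrum A
  have hAB : A * cfc (fun x : ℝ => x⁻¹) A = cfc (fun x : ℝ => x * x⁻¹) A := by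
    conv_lhs => rw [← hid]
    rw [hid, cfc_mul _ _ A (hc _) (hc _), hid]
  have hBA : cfc (fun x : ℝ => x⁻¹) A * A = cfc (fun x : ℝ => x⁻¹ * x) A := by
    rw [cfc_mul _ _ A (hc _) (hc _), hid]
  refine ⟨?_, ?_, ?_, ?_⟩
  · have h := cfc_mul (fun x : ℝ => x * x⁻¹) (fun x => x) A (hc _) (hc _)
    rw [hid] at h
    rw [hAB, ← h]
    simp only [mul_inv_mul_cancel]
    exact hid
  · rw [hBA, ← cfc_mul _ _ A (hc _) (hc _)]
    refine cfc_congr fun x _ => ?_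
    by_cases hx : x = 0
    · simp [hx]
    · simp [hx]
  · rw [hAB]
    exact cfc_predicate (R := ℝ) _ A
  · rw [hBA]
    exact cfc_predicate (R := ℝ) _ A

theorem eq_zero_or_le_of_mem_spectrum {n : ℕ} {A : QOperator (Fin n)} {η : ℝ}
    (hη : IsLeast {μ : ℝ | μ ≠ 0 ∧ Module.End.HasEigenvalue (Matrix.toLin' A) (μ : ℂ)} η)
    {x : ℝ} (hx : x ∈ spectrum ℝ A) : x = 0 ∨ η ≤ x := by
  by_cases h0 : x = 0
  · exact Or.inl h0
  · refine Or.inr (hη.2 ⟨h0, ?_⟩)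
    rw [Module.End.hasEigenvalue_iff_mem_spectrum, Matrix.spectrum_toLin']
    exact (spectrum.algebraMap_mem_iff ℂ).2 hx

end MoorePenrose

/-! ### Assembly of the circuit and the error bound -/

section Assembly

open Polynomial

/-- Realization of `x r(x²)` by a quantum circuit with one additional ancilla qubit. -/
theorem exists_circuit_polynomial (m n : ℕ) {r : ℝ[X]} (hr : r ≠ 0)
    (hr1 : ∀ y ∈ Set.Ioo (0 : ℝ) 1, y * r.eval y ^ 2 ≤ 1) :
    ∃ c : QueryCircuit (Fin m ⊕ Fin n) (Fin (m + 1) ⊕ Fin n),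
      c.queryCount = 2 * r.natDegree + 1 ∧
      c.gateCount ≤ 200 * (m + 1) * (2 * r.natDegree + 2) + 2 ∧
      ∀ U ∈ Matrix.unitaryGroup (Fin m ⊕ Fin n → Fin 2) ℂ, (ancillaBlock U).IsHermitian →
        ancillaBlock (c.toOperator U) = aeval (ancillaBlock U) (X * r.comp (X ^ 2)) := by
  obtain ⟨φ₀, l, hl, hpair⟩ := exists_sequencePair_re hr hr1
  obtain ⟨c, hq, hg, hc⟩ := exists_circuit_average m n φ₀ l
  refine ⟨c, by rw [hq, hl], by rw [hl] at hg; exact hg, fun U hU hA => ?_⟩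
  have hodd : Odd l.length := ⟨_, hl⟩
  -- For a Hermitian block, `AᴴA = A²`, so the sum of the two conjugate sequences is `2 A r(A²)`.
  rw [hc, ancillaBlock_alternatingSequence hU φ₀ hodd,
    ancillaBlock_alternatingSequence hU (-φ₀) (by rwa [List.length_map]), sequencePair_neg,
    ← mul_add, ← map_add, hpair, hA.eq, map_mul (aeval _) X, aeval_X, aeval_comp, map_pow, aeval_X,
    map_mul, aeval_map_algebraMap, map_ofNat, ← sq]
  rw [show (2 : QOperator (Fin n)) = (2 : ℂ) • 1 by rw [two_smul, one_add_one_eq_two],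
    smul_mul_assoc, one_mul, mul_smul_comm, smul_smul]
  norm_num

/-- The number of repetitions after which the filter is accurate to `t`. -/
theorem exists_filter_length {t : ℝ} (ht : 0 < t) : ∃ M : ℕ, 0 < M ∧
    (M : ℝ) ≤ 21 * max 1 (Real.log (1 / t)) ∧ (243 / 256 : ℝ) ^ M ≤ t := by
  set L := max 1 (Real.log (1 / t))
  have hL : 1 ≤ L := le_max_left _ _
  have hLt : Real.log (1 / t) ≤ L := le_max_right _ _
  -- The factor `20` suffices because `log (243/256) ≤ -13/256` and `20 · 13 ≥ 256`.
  have hceil := Nat.le_ceil (20 * L)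
  refine ⟨⌈20 * L⌉₊, Nat.ceil_pos.2 (by linarith), ?_, ?_⟩
  · have := (Nat.ceil_lt_add_one (by linarith : 0 ≤ 20 * L)).le
    linarith
  · rw [← Real.log_le_log_iff (by positivity) ht, Real.log_pow]
    have h1 : Real.log (243 / 256) ≤ 243 / 256 - 1 := Real.log_le_sub_one_of_pos (by norm_num)
    rw [one_div, Real.log_inv] at hLt
    nlinarith

end Assembly

open Polynomial in
theorem mainTheorem4 :
    ∃ C : ℝ, 0 < C ∧
      ∀ (n m : ℕ) (α η ε : ℝ), 0 < η → η ≤ α → 0 < ε → ε ≤ 1 / 2 →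
        ∃ (p : Polynomial ℝ) (c : QueryCircuit (Fin m ⊕ Fin n) (Fin (m + 1) ⊕ Fin n)),
          (∀ x : ℝ, p.eval (-x) = -p.eval x) ∧
          (p.natDegree : ℝ) ≤ C * ((α / η) * max 1 (Real.log (1 / (η * ε)))) ∧
          c.queryCount = p.natDegree ∧
          (c.gateCount : ℝ) ≤ C * ((p.natDegree : ℝ) * ((m : ℝ) + (n : ℝ) + 1)) ∧
          ∀ (A : QOperator (Fin n)) (U : QOperator (Fin m ⊕ Fin n)),
            A.PosSemidef →
            IsLeast {μ : ℝ | μ ≠ 0 ∧ Module.End.HasEigenvalue (Matrix.toLin' A) (μ : ℂ)} η →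
            IsBlockEncoding α m 0 U A →
              IsBlockEncoding (4 / (3 * η)) (m + 1) 0 (c.toOperator U)
                (Polynomial.aeval (α⁻¹ • A) p) ∧
              ∃ Aplus : QOperator (Fin n), IsMoorePenroseInverse A Aplus ∧
                ‖(4 / (3 * η)) • ancillaBlock (c.toOperator U) - Aplus‖ ≤ ε := by
  -- The degree needs `2 · 252 + 1 = 505`; the value `600` also absorbs the gate count.
  refine ⟨600, by norm_num, fun n m α η ε hη hηα hε _ => ?_⟩
  have hα : 0 < α := hη.trans_le hηα
  set L := max 1 (Real.log (1 / (η * ε)))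
  have hL : 1 ≤ L := le_max_left _ _
  -- The tolerance is `η ε` because the filter error is divided by an eigenvalue as small as `η`.
  obtain ⟨M, hM, hML, hMt⟩ := exists_filter_length (mul_pos hη hε)
  have ha : 0 < η / α := by positivity
  have ha1 : η / α ≤ 1 := (div_le_one hα).2 hηα
  obtain ⟨R, hRdeg, hR0, hR1, hRle, hRinv⟩ := exists_filterPolynomial ha ha1 hM
  have hRne : R ≠ 0 := by
    rintro rfl
    have h1 := hRinv 1 ha1 le_rfl
    have h2 : (243 / 256 : ℝ) ^ M < 1 := pow_lt_one₀ (by norm_num) (by norm_num) hM.ne'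
    simp only [eval_zero, mul_zero, sub_zero] at h1
    linarith
  have hs : (0 : ℝ) < 3 * η / (4 * α) := by positivity
  have hrne : C (3 * η / (4 * α)) * R ≠ 0 := mul_ne_zero (C_ne_zero.2 hs.ne') hRne
  have hrdeg : (C (3 * η / (4 * α)) * R).natDegree = R.natDegree := natDegree_C_mul hs.ne'
  -- The scale `3 η / (4 α)` is the reciprocal of the bound `4 / (3 a)` with `a = η / α`; multiplied
  -- by `4 / (3 η)` it leaves `α⁻¹`, which turns the inverse of `A / α` into that of `A`.
  have hr1 : ∀ y ∈ Set.Ioo (0 : ℝ) 1, y * (C (3 * η / (4 * α)) * R).eval y ^ 2 ≤ 1 := by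
    intro y hy
    have hx0 : 0 < √y := Real.sqrt_pos.2 hy.1
    have hx1 : √y ≤ 1 := Real.sqrt_le_one.2 hy.2.le
    have hxy : √y ^ 2 = y := Real.sq_sqrt hy.1.le
    have h1 := hRle _ hx0 hx1
    have h2 := hR0 _ hx0.le hx1
    rw [hxy] at h1 h2
    have h3 : 0 ≤ R.eval y := nonneg_of_mul_nonneg_right h2 hy.1
    have h4 : 3 * η / (4 * α) * (√y * R.eval y) ≤ 1 := by
      calc _ ≤ 3 * η / (4 * α) * (4 / (3 * (η / α))) := mul_le_mul_of_nonneg_left h1 hs.le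
        _ = 1 := by field_simp
    have h5 := pow_le_one₀ (n := 2) (by positivity) h4
    rw [eval_mul, eval_C]
    calc y * (3 * η / (4 * α) * R.eval y) ^ 2 = √y ^ 2 * (3 * η / (4 * α) * R.eval y) ^ 2 := by
          rw [hxy]
      _ = (3 * η / (4 * α) * (√y * R.eval y)) ^ 2 := by ring
      _ ≤ 1 := h5
  obtain ⟨c, hq, hg, hc⟩ := exists_circuit_polynomial m n hrne hr1
  rw [hrdeg] at hq hg
  have hcomp : R.comp (X ^ 2) ≠ 0 := by
    intro h0
    rw [comp_eq_zero_iff] at h0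
    rcases h0 with h0 | ⟨-, h0⟩
    · exact hRne h0
    · have := congrArg natDegree h0
      rw [natDegree_X_pow, natDegree_C] at this
      omega
  have hpdeg : (C α⁻¹ * (X * R.comp (X ^ 2))).natDegree = 2 * R.natDegree + 1 := by
    rw [natDegree_C_mul (inv_ne_zero hα.ne'), natDegree_X_mul hcomp, natDegree_comp,
      natDegree_X_pow, mul_comm]
  have hpeval : ∀ x : ℝ, (C α⁻¹ * (X * R.comp (X ^ 2))).eval x =
      α⁻¹ * (x * R.eval (x ^ 2)) := by
    intro x
    simp [eval_comp]
  refine ⟨C α⁻¹ * (X * R.comp (X ^ 2)), c, ?_, ?_, by rw [hq, hpdeg], ?_, ?_⟩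
  · intro x
    rw [hpeval, hpeval, neg_sq]
    ring
  · rw [hpdeg]
    push_cast
    have hκ : 1 ≤ α / η := (one_le_div hη).2 hηα
    have h1 : (R.natDegree : ℝ) ≤ 252 * (α / η * L) := by
      calc (R.natDegree : ℝ) ≤ 12 * M / (η / α) := hRdeg
        _ = 12 * (α / η) * M := by field_simp
        _ ≤ 12 * (α / η) * (21 * L) := by gcongr
        _ = 252 * (α / η * L) := by ring
    have h2 : 1 ≤ α / η * L := one_le_mul_of_one_le_of_one_le hκ hL
    linarith
  · rw [hpdeg]
    have h1 : (c.gateCount : ℝ) ≤ 200 * (m + 1) * (2 * R.natDegree + 2) + 2 := by exact_mod_cast hg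
    have hm : (0 : ℝ) ≤ m := Nat.cast_nonneg m
    have hn : (0 : ℝ) ≤ n := Nat.cast_nonneg n
    have hd : (0 : ℝ) ≤ R.natDegree := Nat.cast_nonneg _
    push_cast
    nlinarith [mul_nonneg hm hd, mul_nonneg hn hd]
  · intro A U hA hleast hU
    have hsa : IsSelfAdjoint A := hA.isHermitian.isSelfAdjoint
    have hAU : A = α • ancillaBlock U := by
      have := hU.error_le
      exact sub_eq_zero.1 (norm_le_zero_iff.1 this)
    have hblock : ancillaBlock U = α⁻¹ • A := by
      rw [hAU, smul_smul, inv_mul_cancel₀ hα.ne', one_smul]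
    have hherm : (ancillaBlock U).IsHermitian := by
      rw [hblock]
      exact (IsSelfAdjoint.smul (IsSelfAdjoint.all _) hsa)
    have hcU := hc U hU.unitary hherm
    have hkey : (4 / (3 * η)) • ancillaBlock (c.toOperator U) =
        aeval (α⁻¹ • A) (C α⁻¹ * (X * R.comp (X ^ 2))) := by
      rw [hcU, hblock, mul_comp, C_comp, mul_left_comm, ← smul_eq_C_mul, ← smul_eq_C_mul, map_smul,
        map_smul, smul_smul]
      congr 1
      field_simp
    have huni := QueryCircuit.toOperator_mem_unitaryGroup hU.unitary c
    refine ⟨⟨huni, ?_, ?_⟩, cfc (fun x : ℝ => x⁻¹) A, isMoorePenroseInverse_cfc_inv hsa, ?_⟩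
    -- The norm bound needs no estimate of the polynomial, since its value is a multiple of a block
    -- of a unitary.
    · rw [← hkey, norm_smul, Real.norm_of_nonneg (by positivity)]
      exact mul_le_of_le_one_right (by positivity) (norm_ancillaBlock_le huni)
    · rw [hkey, sub_self, norm_zero]
    · have hpA : aeval (α⁻¹ • A) (C α⁻¹ * (X * R.comp (X ^ 2))) =
          cfc (fun x : ℝ => α⁻¹ * (α⁻¹ * x * R.eval ((α⁻¹ * x) ^ 2))) A := by
        have h1 : α⁻¹ • A = aeval A (C α⁻¹ * X) := by
          rw [← smul_eq_C_mul, map_smul, aeval_X]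
        rw [h1, ← aeval_comp, ← cfc_polynomial _ A hsa]
        refine cfc_congr fun x _ => ?_
        simp [eval_comp]
      have hcont := continuousOn_spectrum A
      rw [hkey, hpA, ← cfc_sub _ _ A (hcont _) (hcont _)]
      refine norm_cfc_le hε.le fun x hx => ?_
      -- At the eigenvalue `0` both functions vanish. At the others the error is `x⁻¹ (1 - F(x /
      -- α))`, with `F` the filter.
      rcases eq_zero_or_le_of_mem_spectrum hleast hx with rfl | hηx
      · simpa using hε.le
      · have hx0 : 0 < x := hη.trans_le hηx
        have hxα : x ≤ α := by
          have := spectrum.norm_le_norm_of_mem hx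
          rw [Real.norm_of_nonneg hx0.le] at this
          exact this.trans hU.norm_le
        have ht0 : 0 < α⁻¹ * x := by positivity
        have hta : η / α ≤ α⁻¹ * x := by
          rw [div_eq_inv_mul]
          gcongr
        have ht1 : α⁻¹ * x ≤ 1 := by
          rw [← div_eq_inv_mul]
          exact (div_le_one hα).2 hxα
        have h1 := hRinv _ hta ht1
        have h2 := hR1 _ ht0.le ht1
        have heq : α⁻¹ * (α⁻¹ * x * R.eval ((α⁻¹ * x) ^ 2)) - x⁻¹ =
            -(x⁻¹ * (1 - (α⁻¹ * x) ^ 2 * R.eval ((α⁻¹ * x) ^ 2))) := by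
          generalize R.eval ((α⁻¹ * x) ^ 2) = v
          field_simp
          ring
        rw [heq, norm_neg, Real.norm_of_nonneg (mul_nonneg (by positivity) (by linarith))]
        calc _ ≤ η⁻¹ * (η * ε) := by
              refine mul_le_mul (inv_anti₀ hη hηx) (h1.trans hMt) (by linarith) (by positivity)
          _ = ε := by field_simp
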